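/- Work over $\mathbb{C}$ and let $n,m\ge 0$ be integers. Let $X\subset\mathbb{P}^n$ be a closed subscheme of dimension $0$ supported at one point $P\in\mathbb{P}^n$. For a $0$-dimensional scheme $Y$ let $\ell(Y)=\dim_{\mathbb{C}}\Gamma(Y,\mathcal{O}_Y)$ be its length, and let $\cap$ denote the scheme-theoretic intersection. The scheme $X$ is called $m$-symmetric if $\ell(X\cap L)=m$ for every line $L\subset\mathbb{P}^n$ passing through $P$. Then $X$ is $m$-symmetric if and only if $\ell(X\cap C)=m$ for every curve $C\subset\mathbb{P}^n$ that passes through $P$ and is smooth at $P$, where a curve is a closed subscheme all of whose irreducible components have dimension $1$. -/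

import Mathlib

open AlgebraicGeometry

/-- The standard grading by degree of the coordinate ring `ℂ[x₀, …, xₙ]`. -/
noncomputable abbrev coordGrading (n : ℕ) : ℕ → Submodule ℂ (MvPolynomial (Fin (n + 1)) ℂ) :=
  MvPolynomial.homogeneousSubmodule (Fin (n + 1)) ℂ

noncomputable instance coordGradedRing (n : ℕ) : GradedRing (coordGrading n) :=
  MvPolynomial.gradedAlgebra

/-- Complex projective space `ℙⁿ = Proj ℂ[x₀, …, xₙ]`, as a scheme. -/
noncomputable abbrev ComplexPn (n : ℕ) : Scheme :=
  Proj (coordGrading n)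

/-- A closed subscheme of `ℙⁿ` is given by its (quasi-coherent) ideal sheaf `I_X`; the scheme
itself is `X.subscheme`, its set of points in `ℙⁿ` is `X.support`. -/
abbrev ClosedSubscheme (n : ℕ) : Type :=
  (ComplexPn n).IdealSheafData

namespace ClosedSubscheme

variable {n : ℕ}

/-- The scheme-theoretic intersection `X ∩ Y`, whose ideal sheaf is `I_X + I_Y`. -/
noncomputable def inter (X Y : ClosedSubscheme n) : ClosedSubscheme n :=
  X ⊔ Y

/-- The length `ℓ(X)` of a `0`-dimensional (hence affine) closed subscheme: the length of its ring
of global functions `Γ(X, 𝒪_X)`, which is an Artinian ring. Since `ℂ` is algebraically closed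
this is also `dim_ℂ Γ(X, 𝒪_X)`. It is only used for `0`-dimensional schemes. -/
noncomputable def length (X : ClosedSubscheme n) : ℕ∞ :=
  Module.length Γ(X.subscheme, ⊤) Γ(X.subscheme, ⊤)

/-- `X` is a `0`-dimensional scheme supported at the one point `P`. -/
def IsZeroDimSupportedAt (X : ClosedSubscheme n) (P : ComplexPn n) : Prop :=
  topologicalKrullDim X.subscheme = 0 ∧ (X.support : Set (ComplexPn n)) = {P}

/-- The linear subspace of `ℙⁿ` defined by the vanishing of a set of forms `W`, with its reduced
scheme structure. -/
noncomputable def reducedZeroLocus (W : Set (MvPolynomial (Fin (n + 1)) ℂ)) : ClosedSubscheme n :=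
  Scheme.IdealSheafData.vanishingIdeal (X := ComplexPn n)
    ⟨ProjectiveSpectrum.zeroLocus (coordGrading n) W,
      ProjectiveSpectrum.isClosed_zeroLocus (coordGrading n) W⟩

/-- `L` is a line: the common zero locus of an `(n - 1)`-dimensional space of linear forms. -/
def IsLine (L : ClosedSubscheme n) : Prop :=
  ∃ W : Submodule ℂ (MvPolynomial (Fin (n + 1)) ℂ),
    W ≤ MvPolynomial.homogeneousSubmodule (Fin (n + 1)) ℂ 1 ∧
    Module.finrank ℂ W + 1 = n ∧
    L = reducedZeroLocus (W : Set (MvPolynomial (Fin (n + 1)) ℂ))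

/-- `C` is a curve: every irreducible component of `C` has dimension `1`. No irreducibility or
reducedness is asked. -/
def IsCurve (C : ClosedSubscheme n) : Prop :=
  ∀ Z ∈ irreducibleComponents C.subscheme, topologicalKrullDim Z = 1

/-- `P` is a smooth (nonsingular) point of `C`: it lies on `C` and the local ring `𝒪_{C,P}` is
regular. -/
def IsSmoothAt (C : ClosedSubscheme n) (P : ComplexPn n) : Prop :=
  ∃ x : C.subscheme, C.subschemeι x = P ∧ IsRegularLocalRing (C.subscheme.presheaf.stalk x)

/-- `X` (a `0`-dimensional scheme supported at `P`) is `m`-symmetric: every line through `P` meets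
`X` in a scheme of length `m`. -/
def IsSymmetric (X : ClosedSubscheme n) (P : ComplexPn n) (m : ℕ) : Prop :=
  ∀ L : ClosedSubscheme n, L.IsLine → P ∈ L.support → (X.inter L).length = m

end ClosedSubscheme

/-! ### Length of quotient rings -/

section Length

theorem length_self_eq_of_ringEquiv {R S : Type*} [CommRing R] [CommRing S] (e : R ≃+* S) :
    Module.length R R = Module.length S S := by
  apply WithBot.coe_injective
  rw [Module.coe_length, Module.coe_length]
  exact Order.krullDim_eq_of_orderIso e.idealComapOrderIso.symm

theorem length_quotient_self {R : Type*} [CommRing R] (I : Ideal R) :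
    Module.length (R ⧸ I) (R ⧸ I) = Module.length R (R ⧸ I) :=
  (Module.length_eq_of_surjective (S := R) (R := R ⧸ I) (M := R ⧸ I)
    Ideal.Quotient.mk_surjective).symm

/-- A ring map which is surjective modulo `I'` identifies the quotient by the preimage of `I'` with
the quotient by `I'`, so that the two have the same length. -/
theorem length_quotient_eq_of_surjective {R S : Type*} [CommRing R] [CommRing S] (φ : R →+* S)
    {I : Ideal R} {I' : Ideal S} (hφ : Function.Surjective ((Ideal.Quotient.mk I').comp φ))
    (h : I'.comap φ = I) :
    Module.length (R ⧸ I) (R ⧸ I) = Module.length (S ⧸ I') (S ⧸ I') := by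
  have hk : RingHom.ker ((Ideal.Quotient.mk I').comp φ) = I := by
    rw [← RingHom.comap_ker, Ideal.mk_ker, h]
  exact length_self_eq_of_ringEquiv
    ((Ideal.quotEquivOfEq hk.symm).trans (RingHom.quotientKerEquivOfSurjective hφ))

theorem length_quotient_span_pow {R : Type*} [CommRing R] [IsDomain R] {t : R} (ht : t ≠ 0)
    (hmax : (Ideal.span {t}).IsMaximal) (k : ℕ) :
    Module.length (R ⧸ Ideal.span {t ^ k}) (R ⧸ Ideal.span {t ^ k}) = k := by
  rw [length_quotient_self]
  have h1 : Ring.ord R t = 1 := by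
    rw [Ring.ord, Module.length_eq_one_iff]
    exact isSimpleModule_iff_isCoatom.mpr (Ideal.isMaximal_def.mp hmax)
  have := Ring.ord_pow (R := R) (mem_nonZeroDivisors_of_ne_zero ht) k
  rw [h1] at this
  simpa [Ring.ord] using this

end Length

namespace MvPolynomial

section Homogeneous

variable {σ K : Type*} [CommRing K]

theorem aeval_mul_left_of_isHomogeneous {B : Type*} [CommRing B] [Algebra K B] {f : MvPolynomial σ K}
    {d : ℕ} (hf : f.IsHomogeneous d) (c : B) (g : σ → B) :
    aeval (fun s => c * g s) f = c ^ d * aeval g f := by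
  rw [aeval_def, aeval_def, eval₂_eq, eval₂_eq, Finset.mul_sum]
  refine Finset.sum_congr rfl fun e he => ?_
  have hd : ∑ i ∈ e.support, e i = d := by
    have := hf (mem_support_iff.mp he)
    rw [Finsupp.weight_apply] at this
    simpa [Finsupp.sum] using this
  simp_rw [mul_pow, Finset.prod_mul_distrib]
  rw [Finset.prod_pow_eq_pow_sum, hd]
  ring

theorem sub_mem_of_forall_X {B : Type*} [CommRing B] [Algebra K B] (φ ψ : MvPolynomial σ K →ₐ[K] B)
    (I : Ideal B) (h : ∀ s, φ (X s) - ψ (X s) ∈ I) (f : MvPolynomial σ K) : φ f - ψ f ∈ I := by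
  have : (Ideal.Quotient.mkₐ K I).comp φ = (Ideal.Quotient.mkₐ K I).comp ψ := by
    ext s
    simpa using! Ideal.Quotient.eq.mpr (h s)
  exact Ideal.Quotient.eq.mp (DFunLike.congr_fun this f)

/-- The kernel of an algebra map out of a polynomial ring is contained in any ideal modulo which
the map has a left inverse. -/
theorem ker_le_of_leftInverse {B : Type*} [CommRing B] [Algebra K B]
    (φ : MvPolynomial σ K →ₐ[K] B) (ψ : B →ₐ[K] MvPolynomial σ K) (I : Ideal (MvPolynomial σ K))
    (h : ∀ s, X s - ψ (φ (X s)) ∈ I) : RingHom.ker φ ≤ I := by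
  intro f hf
  have := sub_mem_of_forall_X (AlgHom.id K _) (ψ.comp φ) I h f
  rw [RingHom.mem_ker] at hf
  simpa [hf] using this

end Homogeneous

section LineHom

variable {σ K : Type*} [Field K]

/-- Restriction of polynomial functions to the line through the origin in the direction `a`. -/
noncomputable def lineHom (a : σ → K) : MvPolynomial σ K →ₐ[K] Polynomial K :=
  aeval (fun s => Polynomial.X * Polynomial.C (a s))

theorem lineHom_X (a : σ → K) (s : σ) :
    lineHom a (X s) = Polynomial.X * Polynomial.C (a s) := by simp [lineHom]

theorem lineHom_of_isHomogeneous (a : σ → K) {f : MvPolynomial σ K} {d : ℕ}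
    (hf : f.IsHomogeneous d) : lineHom a f = Polynomial.X ^ d * Polynomial.C (eval a f) := by
  rw [lineHom, aeval_mul_left_of_isHomogeneous hf]
  congr 1
  exact (aeval_algebraMap_apply (Polynomial K) a f).trans (by simp [aeval_eq_eval])

theorem coeff_lineHom (a : σ → K) (f : MvPolynomial σ K) (d : ℕ) :
    (lineHom a f).coeff d = eval a (homogeneousComponent d f) := by
  conv_lhs => rw [← sum_homogeneousComponent f, map_sum]
  rw [Polynomial.finsetSum_coeff]
  simp_rw [lineHom_of_isHomogeneous a (homogeneousComponent_isHomogeneous _ f),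
    Polynomial.coeff_X_pow_mul', Polynomial.coeff_C]
  by_cases hd : d < f.totalDegree + 1
  · rw [Finset.sum_eq_single d]
    · simp
    · intro b _ hb
      split_ifs with h1 h2 <;> first | rfl | omega
    · simp [hd]
  · rw [homogeneousComponent_eq_zero d f (by omega), map_zero]
    refine Finset.sum_eq_zero fun b hb => ?_
    rw [Finset.mem_range] at hb
    split_ifs with h1 h2 <;> first | rfl | omega

theorem lineHom_surjective {a : σ → K} (ha : a ≠ 0) : Function.Surjective (lineHom a) := by
  obtain ⟨s, hs⟩ := Function.ne_iff.mp ha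
  have hs : a s ≠ 0 := hs
  rw [← AlgHom.range_eq_top, eq_top_iff, ← Polynomial.adjoin_X, Algebra.adjoin_le_iff,
    Set.singleton_subset_iff]
  refine ⟨X s * C (a s)⁻¹, ?_⟩
  change lineHom a (X s * C (a s)⁻¹) = _
  rw [map_mul, ← algebraMap_eq, AlgHom.commutes, lineHom_X, mul_assoc,
    Polynomial.algebraMap_eq, ← Polynomial.C_mul, mul_inv_cancel₀ hs, Polynomial.C_1, mul_one]

/-- A fat point meets the line in direction `a` in the scheme defined by a power of the
coordinate. -/
theorem map_lineHom_eq_span_pow {a : σ → K} (ha : a ≠ 0) {I : Ideal (MvPolynomial σ K)} {N m : ℕ}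
    (hN : RingHom.ker (constantCoeff (σ := σ) (R := K)) ^ N ≤ I)
    (hm : Module.length (MvPolynomial σ K ⧸ I ⊔ RingHom.ker (lineHom a))
      (MvPolynomial σ K ⧸ I ⊔ RingHom.ker (lineHom a)) = m) :
    I.map (lineHom a) = Ideal.span {Polynomial.X ^ m} := by
  obtain ⟨s, hs⟩ := Function.ne_iff.mp ha
  have hs : a s ≠ 0 := hs
  have hX : (Polynomial.X ^ N : Polynomial K) ∈ I.map (lineHom a) := by
    have h1 : lineHom a (X s ^ N) ∈ I.map (lineHom a) :=
      Ideal.mem_map_of_mem _ (hN (Ideal.pow_mem_pow (by simp [RingHom.mem_ker]) N))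
    rw [map_pow, lineHom_X, mul_pow] at h1
    have := Ideal.mul_mem_right (Polynomial.C (a s)⁻¹ ^ N) _ h1
    rwa [mul_assoc, ← mul_pow, ← Polynomial.C_mul, mul_inv_cancel₀ hs, Polynomial.C_1, one_pow,
      mul_one] at this
  obtain ⟨g, hg⟩ := IsPrincipalIdealRing.principal (I.map (lineHom a))
  rw [Ideal.submodule_span_eq] at hg
  rw [hg, Ideal.mem_span_singleton, dvd_prime_pow Polynomial.prime_X] at hX
  obtain ⟨k, -, hk⟩ := hX
  have hspan : I.map (lineHom a) = Ideal.span {Polynomial.X ^ k} := by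
    rw [hg, Ideal.span_singleton_eq_span_singleton.mpr hk]
  have hmax : (Ideal.span {(Polynomial.X : Polynomial K)}).IsMaximal :=
    PrincipalIdealRing.isMaximal_of_irreducible Polynomial.irreducible_X
  have hlen := length_quotient_eq_of_surjective (lineHom a : MvPolynomial σ K →+* Polynomial K)
    (I := I ⊔ RingHom.ker (lineHom a)) (I' := I.map (lineHom a))
    (Ideal.Quotient.mk_surjective.comp (lineHom_surjective ha))
    (Ideal.comap_map_of_surjective' (lineHom a) (lineHom_surjective ha) I)
  rw [hm, hspan, length_quotient_span_pow Polynomial.X_ne_zero hmax] at hlen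
  have : m = k := by exact_mod_cast hlen
  rw [hspan, this]

theorem ker_lineHom_le {a : σ → K} (ha : a ≠ 0) [Fintype σ] {I : Ideal (MvPolynomial σ K)}
    (h : ∀ c : σ → K, ∑ s, c s * a s = 0 → ∑ s, C (c s) * X s ∈ I) :
    RingHom.ker (lineHom a) ≤ I := by
  classical
  obtain ⟨s, hs⟩ := Function.ne_iff.mp ha
  have hs : a s ≠ 0 := hs
  refine ker_le_of_leftInverse (lineHom a) (Polynomial.aeval (C (a s)⁻¹ * X s)) I fun r => ?_
  have := h (Pi.single r 1 - Pi.single s (a r * (a s)⁻¹)) (by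
    simp [sub_mul, Finset.sum_sub_distrib, Pi.single_apply, hs])
  simp only [Pi.sub_apply, map_sub, sub_mul, Finset.sum_sub_distrib, Pi.single_apply,
    apply_ite C, ite_mul, map_one, one_mul, map_zero, zero_mul, Finset.sum_ite_eq',
    Finset.mem_univ, if_true, map_mul] at this
  rw [lineHom_X, map_mul, Polynomial.aeval_X, Polynomial.aeval_C, algebraMap_eq]
  convert this using 1
  ring

end LineHom

variable {σ K D : Type*} [Field K] [CommRing D] [Algebra K D]

/-- `g : K[σ] → D` is the localisation at the origin of the quotient by `J`. -/
structure IsLocalRingAtOrigin (J : Ideal (MvPolynomial σ K)) (g : MvPolynomial σ K →ₐ[K] D) :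
    Prop where
  isUnit_iff : ∀ s, IsUnit (g s) ↔ constantCoeff s ≠ 0
  surj : ∀ d, ∃ a s, constantCoeff s ≠ 0 ∧ d * g s = g a
  ker : ∀ a, g a = 0 ↔ ∃ s, constantCoeff s ≠ 0 ∧ s * a ∈ J

namespace IsLocalRingAtOrigin

variable {J : Ideal (MvPolynomial σ K)} {g : MvPolynomial σ K →ₐ[K] D}

theorem exists_mul_mem_of_mem_map (h : IsLocalRingAtOrigin J g) {I : Ideal (MvPolynomial σ K)}
    {d : D} (hd : d ∈ I.map g) : ∃ a ∈ I, ∃ s, constantCoeff s ≠ 0 ∧ d * g s = g a := by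
  induction hd using Submodule.span_induction with
  | mem x hx =>
    obtain ⟨a, ha, rfl⟩ := hx
    exact ⟨a, ha, 1, by simp, by simp⟩
  | zero => exact ⟨0, I.zero_mem, 1, by simp, by simp⟩
  | add x y _ _ hx hy =>
    obtain ⟨a, ha, s, hs, e⟩ := hx
    obtain ⟨b, hb, t, ht, e'⟩ := hy
    refine ⟨a * t + b * s, I.add_mem (I.mul_mem_right _ ha) (I.mul_mem_right _ hb), s * t,
      by simp [hs, ht], ?_⟩
    rw [map_add, map_mul, map_mul, map_mul, ← e, ← e']
    ring
  | smul c x _ hx =>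
    obtain ⟨a, ha, s, hs, e⟩ := hx
    obtain ⟨b, t, ht, e'⟩ := h.surj c
    refine ⟨b * a, I.mul_mem_left _ ha, t * s, by simp [hs, ht], ?_⟩
    rw [smul_eq_mul, map_mul, map_mul, ← e, ← e']
    ring

theorem exists_inverse_mod {I : Ideal (MvPolynomial σ K)} {N : ℕ}
    (hN : RingHom.ker (constantCoeff (σ := σ) (R := K)) ^ N ≤ I) {s : MvPolynomial σ K}
    (hs : constantCoeff s ≠ 0) : ∃ t, 1 - t * s ∈ I := by
  have hmem : 1 - C (constantCoeff s)⁻¹ * s ∈ RingHom.ker (constantCoeff (σ := σ) (R := K)) := by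
    rw [RingHom.mem_ker]
    simp [inv_mul_cancel₀ hs]
  have h1 : (1 - C (constantCoeff s)⁻¹ * s) ^ N ∈ I := hN (Ideal.pow_mem_pow hmem N)
  have h2 : s ∣ 1 - (1 - C (constantCoeff s)⁻¹ * s) ^ N := by
    have := sub_dvd_pow_sub_pow 1 (1 - C (constantCoeff s)⁻¹ * s) N
    rw [one_pow] at this
    refine dvd_trans ⟨C (constantCoeff s)⁻¹, ?_⟩ this
    ring
  obtain ⟨t, ht⟩ := h2
  refine ⟨t, ?_⟩
  rwa [mul_comm t s, ← ht, sub_sub_cancel]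

/-- An ideal containing a power of the maximal ideal of the origin has the same colength in the
quotient by `J` as in its local ring at the origin. -/
theorem length_sup (h : IsLocalRingAtOrigin J g) {I : Ideal (MvPolynomial σ K)} {N : ℕ}
    (hN : RingHom.ker (constantCoeff (σ := σ) (R := K)) ^ N ≤ I) :
    Module.length (MvPolynomial σ K ⧸ I ⊔ J) (MvPolynomial σ K ⧸ I ⊔ J) =
      Module.length (D ⧸ I.map g) (D ⧸ I.map g) := by
  refine length_quotient_eq_of_surjective (g : MvPolynomial σ K →+* D) ?_ ?_
  · intro d
    obtain ⟨d, rfl⟩ := Ideal.Quotient.mk_surjective d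
    obtain ⟨a, s, hs, e⟩ := h.surj d
    obtain ⟨t, ht⟩ := exists_inverse_mod hN hs
    refine ⟨t * a, Ideal.Quotient.eq.mpr ?_⟩
    change g (t * a) - d ∈ I.map g
    have h1 : d * g (1 - t * s) ∈ I.map g := Ideal.mul_mem_left _ _ (Ideal.mem_map_of_mem g ht)
    rw [map_sub, map_one, map_mul, mul_sub, mul_left_comm, e, ← map_mul] at h1
    rw [← neg_mem_iff]
    convert h1 using 1
    ring
  · apply le_antisymm
    · intro a ha
      obtain ⟨b, hb, s, hs, e⟩ := h.exists_mul_mem_of_mem_map (show g a ∈ I.map g from ha)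
      rw [← map_mul, ← sub_eq_zero, ← map_sub, h.ker] at e
      obtain ⟨s', hs', e⟩ := e
      obtain ⟨t, ht⟩ := exists_inverse_mod hN (show constantCoeff (s' * s) ≠ 0 by simp [hs, hs'])
      have h1 : t * (s' * (a * s - b)) ∈ I ⊔ J := Ideal.mul_mem_left _ _ (Ideal.mem_sup_right e)
      have h2 : (1 - t * (s' * s)) * a ∈ I ⊔ J := Ideal.mem_sup_left (I.mul_mem_right _ ht)
      have h3 : t * s' * b ∈ I ⊔ J := Ideal.mem_sup_left (I.mul_mem_left _ hb)
      convert add_mem (add_mem h1 h2) h3 using 1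
      ring
    · refine sup_le Ideal.le_comap_map fun a ha => ?_
      have : g a = 0 := (h.ker a).mpr ⟨1, by simp, by simpa using ha⟩
      change g a ∈ I.map g
      rw [this]
      exact zero_mem _

section DVR

variable [IsDomain D] [IsDiscreteValuationRing D]

open IsLocalRing

theorem exists_sub_mem_maximalIdeal (h : IsLocalRingAtOrigin J g) (d : D) :
    ∃ k : K, d - algebraMap K D k ∈ maximalIdeal D := by
  obtain ⟨a, s, hs, e⟩ := h.surj d
  refine ⟨constantCoeff a * (constantCoeff s)⁻¹, ?_⟩
  have hu : IsUnit (g s) := (h.isUnit_iff s).mpr hs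
  rw [mem_maximalIdeal, mem_nonunits_iff]
  intro hd
  have := (hd.mul hu)
  rw [sub_mul, e, ← AlgHom.commutes g, ← map_mul, ← map_sub, h.isUnit_iff] at this
  apply this
  simp [algebraMap_eq, hs]

/-- The coordinates along a smooth curve germ, with nonzero tangent direction `a`. -/
theorem exists_tangent (h : IsLocalRingAtOrigin J g) {t : D} (ht : Irreducible t) :
    ∃ (a : σ → K) (y : σ → D), a ≠ 0 ∧ (∀ s, g (X s) = t * y s) ∧
      ∀ s, y s - algebraMap K D (a s) ∈ maximalIdeal D := by
  have hmax := ht.maximalIdeal_eq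
  have hy : ∀ s, ∃ y, g (X s) = t * y := by
    intro s
    have : g (X s) ∈ maximalIdeal D := by
      rw [mem_maximalIdeal, mem_nonunits_iff, h.isUnit_iff]
      simp
    rw [hmax] at this
    exact Ideal.mem_span_singleton.mp this
  choose y hy using hy
  choose a ha using fun s => h.exists_sub_mem_maximalIdeal (y s)
  refine ⟨a, y, ?_, hy, ha⟩
  rintro rfl
  obtain ⟨b, s, hs, e⟩ := h.surj t
  have hb : constantCoeff b = 0 := by
    by_contra hb
    have := (h.isUnit_iff b).mpr hb
    rw [← e] at this
    exact ht.not_isUnit (isUnit_of_mul_isUnit_left this)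
  have h2 : g b - algebraMap K D (constantCoeff b) ∈ Ideal.span {t ^ 2} := by
    have h5 := sub_mem_of_forall_X g ((Algebra.ofId K D).comp (aeval (fun _ => (0 : K))))
      (Ideal.span {t ^ 2}) (fun s => ?_) b
    · simpa [Algebra.ofId_apply] using! h5
    · have h3 := ha s
      rw [hmax, Pi.zero_apply, map_zero, sub_zero, Ideal.mem_span_singleton] at h3
      obtain ⟨z, hz⟩ := h3
      rw [hy, hz]
      simp only [AlgHom.comp_apply, aeval_X, map_zero, sub_zero]
      exact Ideal.mem_span_singleton.mpr ⟨z, by ring⟩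
  rw [hb, map_zero, sub_zero, ← e] at h2
  have h4 : t ∈ Ideal.span {t ^ 2} :=
    (Ideal.mul_unit_mem_iff_mem _ ((h.isUnit_iff s).mpr hs)).mp h2
  obtain ⟨z, hz⟩ := Ideal.mem_span_singleton.mp h4
  have : t * (1 - t * z) = 0 := by
    linear_combination hz
  rcases mul_eq_zero.mp this with h5 | h5
  · exact ht.ne_zero h5
  · exact ht.not_isUnit (IsUnit.of_mul_eq_one z (by linear_combination -h5))

theorem map_eq_span_pow [Infinite K] (h : IsLocalRingAtOrigin J g)
    {I : Ideal (MvPolynomial σ K)} (hI : I ≤ RingHom.ker (constantCoeff (σ := σ) (R := K))) {m : ℕ}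
    (hm : ∀ a : σ → K, a ≠ 0 → I.map (lineHom a) = Ideal.span {Polynomial.X ^ m})
    {t : D} (ht : Irreducible t) : I.map g = Ideal.span {t ^ m} := by
  obtain ⟨a, y, ha, hy, hay⟩ := h.exists_tangent ht
  have hgX : g = aeval (fun s => t * y s) := by
    ext s
    simp [hy]
  have hcomp : ∀ (f : MvPolynomial σ K) (d : ℕ), g (homogeneousComponent d f) =
      t ^ d * aeval y (homogeneousComponent d f) := fun f d => by
    rw [hgX, aeval_mul_left_of_isHomogeneous (homogeneousComponent_isHomogeneous d f)]
  have hzero : ∀ f ∈ I, ∀ d < m, homogeneousComponent d f = 0 := by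
    intro f hf d hd
    refine (homogeneousComponent_isHomogeneous d f).eq_zero_of_forall_eval_eq_zero fun b => ?_
    by_cases hb : b = 0
    · subst hb
      rw [← coeff_lineHom]
      have hc : constantCoeff f = 0 := hI hf
      have : lineHom (0 : σ → K) f = 0 := by
        have : lineHom (0 : σ → K) = (Algebra.ofId K _).comp (aeval (fun _ => (0 : K))) := by
          ext s
          simp [lineHom_X]
        rw [this, AlgHom.comp_apply]
        have h0 : (aeval (fun _ => (0 : K))) f = constantCoeff f := by
          simp
        rw [h0, hc, map_zero]
      rw [this, Polynomial.coeff_zero]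
    · rw [← coeff_lineHom]
      have h1 : lineHom b f ∈ Ideal.span {Polynomial.X ^ m} := by
        rw [← hm b hb]
        exact Ideal.mem_map_of_mem _ hf
      exact Polynomial.X_pow_dvd_iff.mp (Ideal.mem_span_singleton.mp h1) d hd
  have hexp : ∀ f ∈ I, ∃ z, g f = t ^ m * (aeval y (homogeneousComponent m f) + t * z) := by
    intro f hf
    have h1 : t ^ (m + 1) ∣ g (f - homogeneousComponent m f) := by
      conv =>
        enter [2, 2, 1]
        rw [← sum_homogeneousComponent f]
      have h2 : ∑ i ∈ Finset.range (f.totalDegree + 1), homogeneousComponent i f -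
          homogeneousComponent m f =
          ∑ i ∈ Finset.range (f.totalDegree + 1),
            (if i = m then 0 else homogeneousComponent i f) := by
        by_cases hmr : m ∈ Finset.range (f.totalDegree + 1)
        · rw [← Finset.add_sum_erase _ _ hmr, ← Finset.add_sum_erase _ _ hmr, if_pos rfl,
            add_sub_cancel_left, zero_add]
          refine Finset.sum_congr rfl fun i hi => (if_neg (Finset.ne_of_mem_erase hi)).symm
        · rw [homogeneousComponent_eq_zero m f (by simpa using! hmr), sub_zero]
          refine Finset.sum_congr rfl fun i hi => (if_neg ?_).symm
          rintro rfl
          exact hmr hi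
      rw [h2, map_sum]
      refine Finset.dvd_sum fun i _ => ?_
      split_ifs with him
      · simp
      · rcases lt_or_gt_of_ne him with hlt | hgt
        · rw [hzero f hf i hlt, map_zero]
          exact dvd_zero _
        · rw [hcomp]
          exact dvd_mul_of_dvd_left (pow_dvd_pow _ hgt) _
    obtain ⟨z, hz⟩ := h1
    refine ⟨z, ?_⟩
    rw [map_sub, hcomp, sub_eq_iff_eq_add] at hz
    rw [hz]
    ring
  apply le_antisymm
  · rw [Ideal.map_le_iff_le_comap]
    intro f hf
    obtain ⟨z, hz⟩ := hexp f hf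
    exact Ideal.mem_span_singleton.mpr ⟨_, hz⟩
  · rw [Ideal.span_singleton_le_iff_mem]
    have h1 : (Polynomial.X ^ m : Polynomial K) ∈ I.map (lineHom a) := by
      rw [hm a ha]
      exact Ideal.mem_span_singleton_self _
    obtain ⟨f, hf, hfa⟩ := (Ideal.mem_map_iff_of_surjective _ (lineHom_surjective ha)).mp h1
    obtain ⟨z, hz⟩ := hexp f hf
    have heval : eval a (homogeneousComponent m f) = 1 := by
      rw [← coeff_lineHom, hfa, Polynomial.coeff_X_pow_self]
    have hmem : aeval y (homogeneousComponent m f) - 1 ∈ maximalIdeal D := by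
      have h2 := sub_mem_of_forall_X (aeval y) ((Algebra.ofId K D).comp (aeval a)) (maximalIdeal D)
        (fun s => by simpa [Algebra.ofId_apply] using hay s) (homogeneousComponent m f)
      rw [AlgHom.comp_apply, aeval_eq_eval] at h2
      simpa [heval] using! h2
    have hunit : IsUnit (aeval y (homogeneousComponent m f) + t * z) := by
      by_contra hcon
      have h3 : t * z ∈ maximalIdeal D := Ideal.mul_mem_right _ _ (by
        rw [ht.maximalIdeal_eq]; exact Ideal.mem_span_singleton_self t)
      have h4 := sub_mem ((mem_maximalIdeal _).mpr hcon) (add_mem hmem h3)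
      refine (mem_maximalIdeal _).mp h4 ?_
      convert isUnit_one using 1
      ring
    refine (Ideal.mul_unit_mem_iff_mem _ hunit).mp ?_
    rw [← hz]
    exact Ideal.mem_map_of_mem _ hf

/-- If all lines through the origin meet the fat point `I` in length `m`, so does every curve
smooth at the origin. -/
theorem length_eq_of_lines [Infinite K] (h : IsLocalRingAtOrigin J g)
    {I : Ideal (MvPolynomial σ K)} (hI : I ≤ RingHom.ker (constantCoeff (σ := σ) (R := K)))
    {N : ℕ} (hN : RingHom.ker (constantCoeff (σ := σ) (R := K)) ^ N ≤ I) {m : ℕ}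
    (hm : ∀ a : σ → K, a ≠ 0 → Module.length (MvPolynomial σ K ⧸ I ⊔ RingHom.ker (lineHom a))
      (MvPolynomial σ K ⧸ I ⊔ RingHom.ker (lineHom a)) = m) :
    Module.length (MvPolynomial σ K ⧸ I ⊔ J) (MvPolynomial σ K ⧸ I ⊔ J) = m := by
  obtain ⟨t, ht⟩ := IsDiscreteValuationRing.exists_irreducible D
  rw [h.length_sup hN, h.map_eq_span_pow hI (fun a ha => map_lineHom_eq_span_pow ha hN (hm a ha)) ht,
    length_quotient_span_pow ht.ne_zero]
  rw [← ht.maximalIdeal_eq]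
  infer_instance

end DVR

end IsLocalRingAtOrigin

end MvPolynomial

namespace ComplexPn

open MvPolynomial HomogeneousLocalization

variable {n : ℕ}

theorem X_mem_coordGrading (i : Fin (n + 1)) : X i ∈ coordGrading n 1 :=
  (mem_homogeneousSubmodule _ _).mpr (isHomogeneous_X _ _)

/-- Dehomogenisation with respect to `x i`, in affine coordinates centred at `p`. -/
noncomputable def dehom (i : Fin (n + 1)) (p : Fin (n + 1) → ℂ) :
    MvPolynomial (Fin (n + 1)) ℂ →ₐ[ℂ] MvPolynomial {j // j ≠ i} ℂ :=
  aeval fun j => if h : j = i then 1 else X ⟨j, h⟩ + C (p j)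

@[simp]
theorem dehom_X_self (i : Fin (n + 1)) (p : Fin (n + 1) → ℂ) : dehom i p (X i) = 1 := by
  simp [dehom]

theorem dehom_X_of_ne (i : Fin (n + 1)) (p : Fin (n + 1) → ℂ) (s : {j // j ≠ i}) :
    dehom i p (X s) = X s + C (p s) := by
  simp [dehom, s.2]

theorem constantCoeff_dehom {i : Fin (n + 1)} {p : Fin (n + 1) → ℂ} (hp : p i = 1)
    (f : MvPolynomial (Fin (n + 1)) ℂ) : constantCoeff (dehom i p f) = eval p f := by
  have : (constantCoeff.comp (dehom i p : MvPolynomial (Fin (n + 1)) ℂ →+* MvPolynomial {j // j ≠ i} ℂ)) = eval p := by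
    ext j
    · simp [dehom]
    · by_cases h : j = i
      · subst h; simp [hp]
      · simp [dehom_X_of_ne i p ⟨j, h⟩]
  exact DFunLike.congr_fun this f

/-- The coordinate ring of the chart `x i ≠ 0` is a polynomial ring. -/
noncomputable def awayToMvPolynomial (i : Fin (n + 1)) (p : Fin (n + 1) → ℂ) :
    Away (coordGrading n) (X i) →+* MvPolynomial {j // j ≠ i} ℂ :=
  (IsLocalization.Away.lift (S := Localization.Away (X i : MvPolynomial (Fin (n + 1)) ℂ)) (X i)
    (g := (dehom i p : MvPolynomial (Fin (n + 1)) ℂ →+* MvPolynomial {j // j ≠ i} ℂ)) (by simp)).comp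
    (algebraMap (Away (coordGrading n) (X i)) (Localization.Away (X i)))

theorem awayToMvPolynomial_mk (i : Fin (n + 1)) (p : Fin (n + 1) → ℂ) (k : ℕ)
    (f : MvPolynomial (Fin (n + 1)) ℂ) (hf : f ∈ coordGrading n (k • 1)) :
    awayToMvPolynomial i p (Away.mk (coordGrading n) (X_mem_coordGrading i) k f hf) =
      dehom i p f := by
  rw [awayToMvPolynomial, RingHom.comp_apply, HomogeneousLocalization.algebraMap_apply, Away.val_mk,
    Localization.mk_eq_mk', IsLocalization.Away.lift, IsLocalization.lift_mk'_spec]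
  simp

theorem eq_zero_of_dehom_eq_zero {i : Fin (n + 1)} {p : Fin (n + 1) → ℂ} {k : ℕ}
    {f : MvPolynomial (Fin (n + 1)) ℂ} (hf : f.IsHomogeneous k) (h : dehom i p f = 0) : f = 0 := by
  let F := FractionRing (MvPolynomial (Fin (n + 1)) ℂ)
  let x : Fin (n + 1) → F := fun j => algebraMap (MvPolynomial (Fin (n + 1)) ℂ) F (X j)
  have hx : x i ≠ 0 := by simp [x]
  let ψ : MvPolynomial {j // j ≠ i} ℂ →ₐ[ℂ] F :=
    aeval fun s => (x i)⁻¹ * x s - algebraMap ℂ F (p s)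
  have h1 : ψ.comp (dehom i p) = aeval (fun j => (x i)⁻¹ * x j) := by
    ext j
    by_cases hj : j = i
    · subst hj; simp [inv_mul_cancel₀ hx]
    · rw [AlgHom.comp_apply, dehom_X_of_ne i p ⟨j, hj⟩]
      rw [map_add, ← MvPolynomial.algebraMap_eq, AlgHom.commutes, aeval_X, aeval_X, sub_add_cancel]
  have h2 : aeval x f = algebraMap _ F f := by
    have : (aeval x : MvPolynomial (Fin (n + 1)) ℂ →ₐ[ℂ] F) = IsScalarTower.toAlgHom ℂ _ F := by
      ext j
      simp [x]
    rw [this]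
    rfl
  have h3 := DFunLike.congr_fun h1 f
  rw [AlgHom.comp_apply, h, map_zero, aeval_mul_left_of_isHomogeneous hf, h2] at h3
  have h4 := (mul_eq_zero.mp h3.symm).resolve_left (pow_ne_zero _ (inv_ne_zero hx))
  exact IsFractionRing.injective (MvPolynomial (Fin (n + 1)) ℂ) F (by rw [h4, map_zero])

theorem awayToMvPolynomial_bijective (i : Fin (n + 1)) (p : Fin (n + 1) → ℂ) :
    Function.Bijective (awayToMvPolynomial i p) := by
  constructor
  · rw [injective_iff_map_eq_zero]
    intro z hz
    obtain ⟨k, f, hf, rfl⟩ := Away.mk_surjective (coordGrading n) (X_mem_coordGrading i) z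
    rw [awayToMvPolynomial_mk] at hz
    have := eq_zero_of_dehom_eq_zero ((mem_homogeneousSubmodule _ _).mp hf) hz
    subst this
    apply HomogeneousLocalization.val_injective
    rw [Away.val_mk, HomogeneousLocalization.val_zero, Localization.mk_zero]
  · intro f
    have hC : ∀ c : ℂ, ∃ z, awayToMvPolynomial i p z = C c := fun c =>
      ⟨Away.mk (coordGrading n) (X_mem_coordGrading i) 0 (C c)
        ((mem_homogeneousSubmodule _ _).mpr (by simpa using isHomogeneous_C _ c)), by
        rw [awayToMvPolynomial_mk, ← algebraMap_eq, AlgHom.commutes, algebraMap_eq]⟩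
    induction f using MvPolynomial.induction_on with
    | C c => exact hC c
    | add f g hf hg =>
      obtain ⟨a, rfl⟩ := hf
      obtain ⟨b, rfl⟩ := hg
      exact ⟨a + b, map_add _ _ _⟩
    | mul_X f s hf =>
      obtain ⟨a, rfl⟩ := hf
      obtain ⟨c, hc⟩ := hC (p s)
      refine ⟨a * (Away.mk (coordGrading n) (X_mem_coordGrading i) 1 (X s.1)
        ((mem_homogeneousSubmodule _ _).mpr (by simpa using isHomogeneous_X ℂ s.1)) - c), ?_⟩
      rw [map_mul, map_sub, awayToMvPolynomial_mk, hc, dehom_X_of_ne, add_sub_cancel_right]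

variable (n) in
/-- The affine chart `x i ≠ 0`. -/
noncomputable def chart (i : Fin (n + 1)) : (ComplexPn n).affineOpens :=
  ⟨Proj.basicOpen (coordGrading n) (X i),
    Proj.isAffineOpen_basicOpen (coordGrading n) (X i) (X_mem_coordGrading i) one_pos⟩

theorem exists_mem_chart (Q : ComplexPn n) : ∃ i, Q ∈ (chart n i).1 := by
  have h := Proj.iSup_basicOpen_eq_top (coordGrading n)
    (fun i : Fin (n + 1) => (X i : MvPolynomial (Fin (n + 1)) ℂ)) (by
      intro f hf
      have hf0 := (HomogeneousIdeal.mem_irrelevant_iff _ _).mp hf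
      have hc : constantCoeff f = 0 := by
        rw [GradedRing.proj_apply] at hf0
        have h2 := (decomposition.decompose'_apply f 0).symm.trans hf0
        rw [homogeneousComponent_zero, C_eq_zero] at h2
        exact h2
      rw [← Set.image_univ, mem_ideal_span_X_image]
      intro e he
      by_contra! hcon
      have : e = 0 := Finsupp.ext fun j => hcon j (Set.mem_univ j)
      subst this
      exact mem_support_iff.mp he hc)
  exact TopologicalSpace.Opens.mem_iSup.mp (h.ge (Set.mem_univ Q))

variable (n) in
/-- Sections over the chart `x i ≠ 0` are homogeneous fractions. -/
noncomputable def awayEquivSection (i : Fin (n + 1)) :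
    Away (coordGrading n) (X i) ≃+* Γ(ComplexPn n, (chart n i).1) :=
  (Proj.basicOpenIsoAway (coordGrading n) (X i) (X_mem_coordGrading i)
    one_pos).commRingCatIsoToRingEquiv

/-- Affine coordinates centred at `p` on the chart `x i ≠ 0`. -/
noncomputable def chartEquiv (i : Fin (n + 1)) (p : Fin (n + 1) → ℂ) :
    MvPolynomial {j // j ≠ i} ℂ ≃+* Γ(ComplexPn n, (chart n i).1) :=
  (RingEquiv.ofBijective _ (awayToMvPolynomial_bijective i p)).symm.trans (awayEquivSection n i)

theorem isUnit_mapId_mk_iff {i : Fin (n + 1)} (Q : ProjectiveSpectrum (coordGrading n))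
    (hQ : X i ∈ Q.asHomogeneousIdeal.toIdeal.primeCompl) (k : ℕ)
    (f : MvPolynomial (Fin (n + 1)) ℂ) (hf : f ∈ coordGrading n (k • 1)) :
    IsUnit (HomogeneousLocalization.mapId (coordGrading n) (Submonoid.powers_le.mpr hQ)
      (Away.mk (coordGrading n) (X_mem_coordGrading i) k f hf)) ↔ f ∉ Q.asHomogeneousIdeal := by
  have h : (HomogeneousLocalization.mapId (coordGrading n) (Submonoid.powers_le.mpr hQ)
      (Away.mk (coordGrading n) (X_mem_coordGrading i) k f hf)).val =
      Localization.mk f ⟨X i ^ k, Submonoid.powers_le.mpr hQ ⟨k, rfl⟩⟩ := rfl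
  rw [← HomogeneousLocalization.isUnit_iff_isUnit_val, h, Localization.mk_eq_mk',
    IsLocalization.AtPrime.isUnit_mk'_iff]
  rfl

theorem mem_basicOpen_awayToSection {i : Fin (n + 1)} {Q : ComplexPn n} (hQ : Q ∈ (chart n i).1)
    (k : ℕ) (f : MvPolynomial (Fin (n + 1)) ℂ) (hf : f ∈ coordGrading n (k • 1)) :
    Q ∈ (ComplexPn n).basicOpen (awayEquivSection n i
      (Away.mk (coordGrading n) (X_mem_coordGrading i) k f hf)) ↔ f ∉ Q.asHomogeneousIdeal := by
  rw [Scheme.mem_basicOpen _ _ _ hQ]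
  have h1 := CategoryTheory.ConcreteCategory.congr_hom
    (ProjectiveSpectrum.Proj.awayToSection_germ (coordGrading n) (X i) Q hQ)
      (Away.mk (coordGrading n) (X_mem_coordGrading i) k f hf)
  have h2 : (ComplexPn n).presheaf.germ (chart n i).1 Q hQ (awayEquivSection n i
      (Away.mk (coordGrading n) (X_mem_coordGrading i) k f hf)) =
    (Proj.stalkIso' (coordGrading n) Q).symm (HomogeneousLocalization.mapId (coordGrading n)
      (Submonoid.powers_le.mpr hQ) (Away.mk (coordGrading n) (X_mem_coordGrading i) k f hf)) := h1
  rw [h2]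
  refine (isUnit_map_iff (Proj.stalkIso' (coordGrading n) Q).symm _).trans ?_
  exact isUnit_mapId_mk_iff Q hQ k f hf

theorem mem_basicOpen_chartEquiv_dehom {i : Fin (n + 1)} {Q : ComplexPn n}
    (hQ : Q ∈ (chart n i).1) (p : Fin (n + 1) → ℂ) {k : ℕ} {f : MvPolynomial (Fin (n + 1)) ℂ}
    (hf : f.IsHomogeneous k) :
    Q ∈ (ComplexPn n).basicOpen (chartEquiv i p (dehom i p f)) ↔ f ∉ Q.asHomogeneousIdeal := by
  rw [← mem_basicOpen_awayToSection hQ k f ((mem_homogeneousSubmodule _ _).mpr (by simpa using hf))]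
  have : chartEquiv i p (dehom i p f) = awayEquivSection n i
      (Away.mk (coordGrading n) (X_mem_coordGrading i) k f
        ((mem_homogeneousSubmodule _ _).mpr (by simpa using hf))) := by
    rw [chartEquiv, RingEquiv.trans_apply]
    have h : (RingEquiv.ofBijective _ (awayToMvPolynomial_bijective i p)).symm (dehom i p f) =
        Away.mk (coordGrading n) (X_mem_coordGrading i) k f
        ((mem_homogeneousSubmodule _ _).mpr (by simpa using hf)) := by
      rw [RingEquiv.symm_apply_eq]
      exact (awayToMvPolynomial_mk i p k f _).symm
    rw [h]
  rw [this]

end ComplexPn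

/-! ### Regular local rings of dimension one -/

theorem isDomain_of_maximalIdeal_eq_span {R : Type*} [CommRing R] [IsLocalRing R]
    [IsNoetherianRing R] {t : R} (ht : IsLocalRing.maximalIdeal R = Ideal.span {t})
    (hdim : ¬ Ring.KrullDimLE 0 R) : IsDomain R := by
  rw [Ring.krullDimLE_zero_iff] at hdim
  push Not at hdim
  obtain ⟨p, hp, hpm⟩ := hdim
  have htp : t ∉ p := by
    intro h
    have h1 : IsLocalRing.maximalIdeal R ≤ p := by
      rw [ht, Ideal.span_singleton_le_iff_mem]
      exact h
    exact hpm ((IsLocalRing.maximalIdeal.isMaximal R).eq_of_le hp.ne_top h1 ▸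
      IsLocalRing.maximalIdeal.isMaximal R)
  have hle : p ≤ IsLocalRing.maximalIdeal R • p := by
    intro a ha
    have h1 := IsLocalRing.le_maximalIdeal hp.ne_top ha
    rw [ht] at h1
    obtain ⟨b, rfl⟩ := Ideal.mem_span_singleton.mp h1
    refine Submodule.smul_mem_smul ?_ ((hp.mem_or_mem ha).resolve_left htp)
    rw [ht]
    exact Ideal.mem_span_singleton_self t
  have hbot : p = ⊥ := Submodule.eq_bot_of_le_smul_of_le_jacobson_bot _ p
    (IsNoetherian.noetherian p) hle (IsLocalRing.maximalIdeal_le_jacobson _)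
  have : (⊥ : Ideal R).IsPrime := hbot ▸ hp
  exact IsDomain.of_bot_isPrime R

theorem IsRegularLocalRing.exists_isDiscreteValuationRing {R : Type*} [CommRing R]
    [IsRegularLocalRing R] (hdim : ringKrullDim R = 1) :
    ∃ _ : IsDomain R, IsDiscreteValuationRing R := by
  have h := IsRegularLocalRing.spanFinrank_maximalIdeal (R := R)
  rw [hdim] at h
  have h1 : (IsLocalRing.maximalIdeal R).spanFinrank = 1 := by exact_mod_cast h
  have hfg : (IsLocalRing.maximalIdeal R).FG := IsNoetherian.noetherian _
  rw [← Submodule.FG.generators_ncard hfg, Set.ncard_eq_one] at h1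
  obtain ⟨t, ht⟩ := h1
  have hspan : IsLocalRing.maximalIdeal R = Ideal.span {t} := by
    rw [← Ideal.submodule_span_eq, ← ht, Submodule.span_generators]
  have hnot : ¬ Ring.KrullDimLE 0 R := by
    rw [Ring.krullDimLE_iff, hdim]
    exact_mod_cast not_le.mpr one_pos
  have hdom := isDomain_of_maximalIdeal_eq_span hspan hnot
  refine ⟨hdom, ?_⟩
  have hnf : ¬ IsField R := fun hf => hnot (by
    rw [Ring.krullDimLE_iff, ringKrullDim_eq_zero_of_isField hf]; rfl)
  exact ((IsDiscreteValuationRing.TFAE R hnf).out 0 4).mpr (show Submodule.IsPrincipal _ from ⟨t, hspan⟩)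

/-! ### Affine charts of closed subschemes -/

namespace AlgebraicGeometry

open CategoryTheory

variable {X : Scheme}

theorem IsAffineOpen.mem_basicOpen_iff {U : X.Opens} (hU : IsAffineOpen U) (x : U) (f : Γ(X, U)) :
    x.1 ∈ X.basicOpen f ↔ f ∉ (hU.primeIdealOf x).asIdeal := by
  have h := hU.fromSpec_preimage_basicOpen f
  have h1 : hU.primeIdealOf x ∈ hU.fromSpec ⁻¹ᵁ X.basicOpen f ↔
    hU.primeIdealOf x ∈ PrimeSpectrum.basicOpen f := by rw [h]; rfl
  rw [PrimeSpectrum.mem_basicOpen] at h1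
  rw [← h1]
  change _ ↔ hU.fromSpec (hU.primeIdealOf x) ∈ X.basicOpen f
  rw [hU.fromSpec_primeIdealOf x]

theorem IsAffineOpen.primeIdealOf_fromSpec {U : X.Opens} (hU : IsAffineOpen U)
    (y : PrimeSpectrum Γ(X, U)) (hy : hU.fromSpec y ∈ U) : hU.primeIdealOf ⟨hU.fromSpec y, hy⟩ = y :=
  hU.fromSpec.isOpenEmbedding.injective (hU.fromSpec_primeIdealOf _)

theorem IsAffineOpen.fromSpec_mem {U : X.Opens} (hU : IsAffineOpen U)
    (y : PrimeSpectrum Γ(X, U)) : hU.fromSpec y ∈ U := by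
  have := hU.range_fromSpec
  exact this.le ⟨y, rfl⟩

namespace Scheme.IdealSheafData

variable (I : X.IdealSheafData) (U : X.affineOpens)

theorem mem_support_iff_le_primeIdealOf (x : U.1) :
    x.1 ∈ I.support ↔ I.ideal U ≤ (U.2.primeIdealOf x).asIdeal := by
  rw [mem_support_iff_of_mem x.2, Scheme.mem_zeroLocus_iff]
  refine forall₂_congr fun f _ => ?_
  rw [U.2.mem_basicOpen_iff x f, not_not]

theorem length_eq_of_support_subset (h : (I.support : Set X) ⊆ U.1) :
    Module.length Γ(I.subscheme, ⊤) Γ(I.subscheme, ⊤) =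
      Module.length (Γ(X, U) ⧸ I.ideal U) (Γ(X, U) ⧸ I.ideal U) := by
  have htop : I.subschemeι ⁻¹ᵁ U.1 = ⊤ := by
    ext x
    simp only [TopologicalSpace.Opens.map_coe, Set.mem_preimage, TopologicalSpace.Opens.coe_top,
      Set.mem_univ, iff_true]
    apply h
    rw [← I.range_subschemeι]
    exact ⟨x, rfl⟩
  rw [← htop]
  exact length_self_eq_of_ringEquiv (I.subschemeObjIso U).commRingCatIsoToRingEquiv

theorem radical_ideal_of_support_eq_singleton (x : U.1) (h : (I.support : Set X) = {x.1}) :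
    (I.ideal U).radical = (U.2.primeIdealOf x).asIdeal := by
  apply le_antisymm
  · have h1 : x.1 ∈ I.support := h.ge rfl
    exact (U.2.primeIdealOf x).2.radical_le_iff.mpr ((I.mem_support_iff_le_primeIdealOf U x).mp h1)
  · rw [Ideal.radical_eq_sInf]
    refine le_sInf fun J hJ => ?_
    obtain ⟨hJ, hJp⟩ := hJ
    let y : PrimeSpectrum Γ(X, U) := ⟨J, hJp⟩
    have hy := U.2.fromSpec_mem y
    have e := IsAffineOpen.primeIdealOf_fromSpec U.2 y hy
    have h2 : U.2.fromSpec y ∈ I.support :=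
      (I.mem_support_iff_le_primeIdealOf U ⟨_, hy⟩).mpr
        (hJ.trans (congrArg PrimeSpectrum.asIdeal e).ge)
    have h4 : x = ⟨U.2.fromSpec y, hy⟩ := Subtype.ext (h.le h2).symm
    exact (congrArg PrimeSpectrum.asIdeal ((congrArg _ h4).trans e)).le

/-- The map from functions on an affine open to the local ring of a closed subscheme. -/
noncomputable def toStalk (x : I.subscheme) (hx : I.subschemeι x ∈ U.1) :
    Γ(X, U) →+* I.subscheme.presheaf.stalk x :=
  (I.subscheme.presheaf.germ (I.subschemeι ⁻¹ᵁ U.1) x hx).hom.comp (I.subschemeι.app U.1).hom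

variable {I U} {x : I.subscheme} (hx : I.subschemeι x ∈ U.1)

theorem isUnit_toStalk_iff (s : Γ(X, U)) :
    IsUnit (I.toStalk U x hx s) ↔ I.subschemeι x ∈ X.basicOpen s := by
  rw [toStalk, RingHom.comp_apply]
  refine (Scheme.mem_basicOpen _ ((I.subschemeι.app U.1).hom s) x hx).symm.trans ?_
  rw [← Scheme.preimage_basicOpen]
  rfl

theorem isLocalization_stalk_subscheme :
    letI := I.subscheme.presheaf.algebra_section_stalk
      (⟨x, hx⟩ : (I.subschemeι ⁻¹ᵁ U.1 : I.subscheme.Opens))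
    IsLocalization.AtPrime (I.subscheme.presheaf.stalk x)
      ((U.2.preimage I.subschemeι).primeIdealOf ⟨x, hx⟩).asIdeal :=
  (U.2.preimage I.subschemeι).isLocalization_stalk ⟨x, hx⟩

theorem app_mem_primeIdealOf_iff (s : Γ(X, U)) :
    (I.subschemeι.app U.1).hom s ∈ ((U.2.preimage I.subschemeι).primeIdealOf ⟨x, hx⟩).asIdeal ↔
      I.subschemeι x ∉ X.basicOpen s := by
  rw [← not_iff_not, not_not, ← IsAffineOpen.mem_basicOpen_iff, ← Scheme.preimage_basicOpen]
  rfl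

theorem toStalk_surj (d : I.subscheme.presheaf.stalk x) :
    ∃ a s, I.subschemeι x ∈ X.basicOpen s ∧ d * I.toStalk U x hx s = I.toStalk U x hx a := by
  let := I.subscheme.presheaf.algebra_section_stalk
    (⟨x, hx⟩ : (I.subschemeι ⁻¹ᵁ U.1 : I.subscheme.Opens))
  have hloc := isLocalization_stalk_subscheme hx
  obtain ⟨⟨a, s⟩, e⟩ := IsLocalization.surj
    ((U.2.preimage I.subschemeι).primeIdealOf ⟨x, hx⟩).asIdeal.primeCompl d
  obtain ⟨a, rfl⟩ := I.subschemeι_app_surjective U a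
  obtain ⟨s, hs⟩ := s
  obtain ⟨s, rfl⟩ := I.subschemeι_app_surjective U s
  refine ⟨a, s, ?_, e⟩
  by_contra hcon
  exact hs ((app_mem_primeIdealOf_iff hx s).mpr hcon)

theorem toStalk_eq_zero_iff (a : Γ(X, U)) :
    I.toStalk U x hx a = 0 ↔ ∃ s, I.subschemeι x ∈ X.basicOpen s ∧ s * a ∈ I.ideal U := by
  let := I.subscheme.presheaf.algebra_section_stalk
    (⟨x, hx⟩ : (I.subschemeι ⁻¹ᵁ U.1 : I.subscheme.Opens))
  have hloc := isLocalization_stalk_subscheme hx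
  have h := IsLocalization.map_eq_zero_iff
    ((U.2.preimage I.subschemeι).primeIdealOf ⟨x, hx⟩).asIdeal.primeCompl
    (I.subscheme.presheaf.stalk x) ((I.subschemeι.app U.1).hom a)
  refine Iff.trans h ⟨?_, ?_⟩
  · rintro ⟨⟨s, hs⟩, e⟩
    obtain ⟨s, rfl⟩ := I.subschemeι_app_surjective U s
    refine ⟨s, ?_, ?_⟩
    · by_contra hcon
      exact hs ((app_mem_primeIdealOf_iff hx s).mpr hcon)
    · rw [← I.ker_subschemeι_app U, RingHom.mem_ker, map_mul]
      exact e
  · rintro ⟨s, hs, e⟩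
    rw [← I.ker_subschemeι_app U, RingHom.mem_ker, map_mul] at e
    exact ⟨⟨(I.subschemeι.app U.1).hom s, fun hcon => (app_mem_primeIdealOf_iff hx s).mp hcon hs⟩, e⟩

theorem isRegularLocalRing_stalk (hx : I.subschemeι x ∈ U.1) (h : IsRegularRing (Γ(X, U) ⧸ I.ideal U)) :
    IsRegularLocalRing (I.subscheme.presheaf.stalk x) := by
  have hreg : IsRegularRing Γ(I.subscheme, I.subschemeι ⁻¹ᵁ U.1) :=
    IsRegularRing.of_ringEquiv (I.subschemeObjIso U).commRingCatIsoToRingEquiv.symm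
  let := I.subscheme.presheaf.algebra_section_stalk
    (⟨x, hx⟩ : (I.subschemeι ⁻¹ᵁ U.1 : I.subscheme.Opens))
  have hloc := isLocalization_stalk_subscheme hx
  have := hreg.isRegularLocalRing_localization
    ((U.2.preimage I.subschemeι).primeIdealOf ⟨x, hx⟩).asIdeal
  exact IsRegularLocalRing.of_ringEquiv (IsLocalization.algEquiv
    ((U.2.preimage I.subschemeι).primeIdealOf ⟨x, hx⟩).asIdeal.primeCompl
    (Localization.AtPrime ((U.2.preimage I.subschemeι).primeIdealOf ⟨x, hx⟩).asIdeal)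
    (I.subscheme.presheaf.stalk x)).toRingEquiv

end Scheme.IdealSheafData

/-! ### Dimension of local rings of curves -/

theorem isMax_of_lt_of_irreducibleComponents
    (hX : ∀ Z ∈ irreducibleComponents X, topologicalKrullDim Z = 1) {x y : X} (hxy : x < y) :
    IsMax y := by
  by_contra hmax
  obtain ⟨z, hyz⟩ := not_isMax_iff.mp hmax
  let Z := irreducibleComponent z
  have hZ := hX Z (irreducibleComponent_mem_irreducibleComponents z)
  have hz : z ∈ Z := mem_irreducibleComponent
  have hy : y ∈ Z := (show z ⤳ y from hyz.le).mem_closed isClosed_irreducibleComponent hz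
  have hx : x ∈ Z := (show y ⤳ x from hxy.le).mem_closed isClosed_irreducibleComponent hy
  let c : Z → TopologicalSpace.IrreducibleCloseds Z := fun w =>
    ⟨closure {w}, isIrreducible_singleton.closure, isClosed_closure⟩
  have hc : ∀ {v w : Z}, v.1 < w.1 → c v < c w := by
    intro v w hvw
    have h1 : ∀ v w : Z, c v ≤ c w ↔ v.1 ≤ w.1 := fun v w => by
      rw [← SetLike.coe_subset_coe]
      change closure {v} ⊆ closure {w} ↔ w.1 ⤳ v.1
      rw [← specializes_iff_closure_subset, subtype_specializes_iff]
    rw [lt_iff_le_not_ge, h1, h1, ← lt_iff_le_not_ge]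
    exact hvw
  have hle : Order.krullDim (TopologicalSpace.IrreducibleCloseds Z) ≤ 1 := hZ.le
  rcases Order.krullDim_le_one_iff.mp hle (c ⟨y, hy⟩) with h | h
  · exact h.not_lt (hc (v := ⟨x, hx⟩) hxy)
  · exact h.not_lt (hc (w := ⟨z, hz⟩) hyz)

theorem ringKrullDim_stalk_eq_one
    (hX : ∀ Z ∈ irreducibleComponents X, topologicalKrullDim Z = 1) {x : X}
    (hx : IsClosed {x}) : ringKrullDim (X.presheaf.stalk x) = 1 := by
  rw [ringKrullDim_stalk_eq_coheight]
  have hle : Order.coheight x ≤ 1 := by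
    refine Order.coheight_le_coe_iff (n := 1).mpr fun y hy => ?_
    have := Order.coheight_eq_zero.mpr (isMax_of_lt_of_irreducibleComponents hX hy)
    rw [this]
    exact one_pos
  have hpos : 0 < Order.coheight x := by
    rw [Order.coheight_pos]
    intro hmax
    let Z := irreducibleComponent x
    have hZ := hX Z (irreducibleComponent_mem_irreducibleComponents x)
    obtain ⟨y, hy⟩ := QuasiSober.sober (isIrreducible_irreducibleComponent (x := x))
      isClosed_irreducibleComponent
    have hyx : y ⤳ x := hy.specializes mem_irreducibleComponent
    have hxy : x ⤳ y := hmax hyx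
    have hxe : y = x := by
      have := specializes_iff_mem_closure.mp hxy
      rwa [hx.closure_eq] at this
    have hZx : Z = {x} := by
      rw [← hx.closure_eq, ← hxe]
      exact hy.def.symm
    have : Subsingleton Z := by
      rw [hZx]
      infer_instance
    have := topologicalKrullDim_zero_of_discreteTopology Z
    rw [hZ] at this
    exact absurd this (by norm_num)
  have : Order.coheight x = 1 := le_antisymm hle (Order.one_le_iff_pos.mpr hpos)
  rw [this]
  rfl

end AlgebraicGeometry

namespace ComplexPn

open MvPolynomial HomogeneousLocalization

variable {n : ℕ}

theorem exists_dehom_eq (i : Fin (n + 1)) (p : Fin (n + 1) → ℂ) (g : MvPolynomial {j // j ≠ i} ℂ) :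
    ∃ (k : ℕ) (f : MvPolynomial (Fin (n + 1)) ℂ), f.IsHomogeneous k ∧ dehom i p f = g := by
  obtain ⟨z, rfl⟩ := (awayToMvPolynomial_bijective i p).2 g
  obtain ⟨k, f, hf, rfl⟩ := Away.mk_surjective (coordGrading n) (X_mem_coordGrading i) z
  refine ⟨k, f, ?_, (awayToMvPolynomial_mk i p k f hf).symm⟩
  simpa using (mem_homogeneousSubmodule _ _).mp hf

/-- `p` are homogeneous coordinates of `P`, normalised in the chart `x i ≠ 0`. -/
structure IsCoordinates (P : ComplexPn n) (i : Fin (n + 1)) (p : Fin (n + 1) → ℂ) : Prop where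
  apply_eq_one : p i = 1
  mem_chart : P ∈ (chart n i).1
  mem_basicOpen_iff : ∀ g, P ∈ (ComplexPn n).basicOpen (chartEquiv i p g) ↔ constantCoeff g ≠ 0

theorem exists_isCoordinates {P : ComplexPn n} (hP : IsClosed {P}) :
    ∃ i p, IsCoordinates P i p := by
  obtain ⟨i, hi⟩ := exists_mem_chart P
  let M := ((chart n i).2.primeIdealOf ⟨P, hi⟩).asIdeal
  have hM : M.IsMaximal := (chart n i).2.primeIdealOf_isMaximal_of_isClosed ⟨P, hi⟩ hP
  have hM' : (M.comap (chartEquiv i 0)).IsMaximal :=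
    Ideal.comap_isMaximal_of_surjective (chartEquiv i 0) (chartEquiv i 0).surjective
  obtain ⟨c, hc⟩ := isMaximal_iff_eq_vanishingIdeal_singleton.mp hM'
  let p : Fin (n + 1) → ℂ := fun j => if h : j = i then 1 else c ⟨j, h⟩
  have hp : p i = 1 := by simp [p]
  refine ⟨i, p, hp, hi, fun g => ?_⟩
  obtain ⟨k, f, hf, rfl⟩ := exists_dehom_eq i p g
  rw [mem_basicOpen_chartEquiv_dehom hi p hf, constantCoeff_dehom hp,
    ← mem_basicOpen_chartEquiv_dehom hi 0 hf]
  have h1 := (chart n i).2.mem_basicOpen_iff ⟨P, hi⟩ (chartEquiv i 0 (dehom i 0 f))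
  have h2 : dehom i 0 f ∈ M.comap (chartEquiv i 0) ↔ eval p f = 0 := by
    rw [hc, mem_vanishingIdeal_singleton_iff]
    have : (aeval c).comp (dehom i 0) = aeval p := by
      ext j
      by_cases h : j = i
      · subst h; simp [p]
      · rw [AlgHom.comp_apply, dehom_X_of_ne i 0 ⟨j, h⟩]
        simp [p, h]
    have h3 := DFunLike.congr_fun this f
    rw [AlgHom.comp_apply] at h3
    rw [h3, aeval_eq_eval]
  exact h1.trans h2.not

theorem IsCoordinates.mem_iff {P : ComplexPn n} {i : Fin (n + 1)} {p : Fin (n + 1) → ℂ}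
    (h : IsCoordinates P i p) {k : ℕ} {f : MvPolynomial (Fin (n + 1)) ℂ} (hf : f.IsHomogeneous k) :
    f ∈ P.asHomogeneousIdeal ↔ eval p f = 0 := by
  rw [← not_iff_not, ← mem_basicOpen_chartEquiv_dehom h.mem_chart p hf, h.mem_basicOpen_iff,
    constantCoeff_dehom h.apply_eq_one]

/-- The equations of a closed subscheme in affine coordinates. -/
noncomputable def chartIdeal (Y : ClosedSubscheme n) (i : Fin (n + 1)) (p : Fin (n + 1) → ℂ) :
    Ideal (MvPolynomial {j // j ≠ i} ℂ) :=
  (Y.ideal (chart n i)).comap (chartEquiv i p)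

variable {P : ComplexPn n} {i : Fin (n + 1)} {p : Fin (n + 1) → ℂ}

theorem length_inter (hP : IsCoordinates P i p) {X : ClosedSubscheme n}
    (hX : (X.support : Set (ComplexPn n)) = {P}) (C : ClosedSubscheme n) :
    (X.inter C).length = Module.length
      (MvPolynomial {j // j ≠ i} ℂ ⧸ chartIdeal X i p ⊔ chartIdeal C i p)
      (MvPolynomial {j // j ≠ i} ℂ ⧸ chartIdeal X i p ⊔ chartIdeal C i p) := by
  have hsupp : ((X.inter C).support : Set (ComplexPn n)) ⊆ (chart n i).1 := by
    have h1 : (X.inter C).support ≤ X.support :=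
      Scheme.IdealSheafData.support_antitone (le_sup_left : X ≤ X ⊔ C)
    intro Q hQ
    have h2 : Q ∈ ({P} : Set (ComplexPn n)) := hX ▸ h1 hQ
    rw [Set.mem_singleton_iff.mp h2]
    exact hP.mem_chart
  refine (Scheme.IdealSheafData.length_eq_of_support_subset _ _ hsupp).trans ?_
  symm
  refine length_quotient_eq_of_surjective
    (chartEquiv i p : MvPolynomial {j // j ≠ i} ℂ →+* Γ(ComplexPn n, (chart n i).1))
    (Ideal.Quotient.mk_surjective.comp (chartEquiv i p).surjective) ?_
  have hmap : ∀ Y : ClosedSubscheme n, chartIdeal Y i p =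
      (Y.ideal (chart n i)).map (chartEquiv i p).symm := fun Y => (Ideal.map_symm _).symm
  rw [hmap, hmap, ← Ideal.map_sup]
  exact (Ideal.map_symm _).symm

theorem chartIdeal_le (hP : IsCoordinates P i p) {X : ClosedSubscheme n}
    (hX : P ∈ X.support) :
    chartIdeal X i p ≤ RingHom.ker (constantCoeff (σ := {j // j ≠ i}) (R := ℂ)) := by
  intro g hg
  rw [RingHom.mem_ker]
  by_contra hcon
  have h1 := (hP.mem_basicOpen_iff g).mpr hcon
  have h2 := (X.mem_support_iff_le_primeIdealOf (chart n i) ⟨P, hP.mem_chart⟩).mp hX hg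
  exact ((chart n i).2.mem_basicOpen_iff ⟨P, hP.mem_chart⟩ _).mp h1 h2

theorem exists_pow_le_chartIdeal (hP : IsCoordinates P i p) {X : ClosedSubscheme n}
    (hX : (X.support : Set (ComplexPn n)) = {P}) :
    ∃ N, RingHom.ker (constantCoeff (σ := {j // j ≠ i}) (R := ℂ)) ^ N ≤ chartIdeal X i p := by
  refine Ideal.exists_pow_le_of_le_radical_of_fg (fun g hg => ?_) (IsNoetherian.noetherian _)
  have h1 := Scheme.IdealSheafData.radical_ideal_of_support_eq_singleton X (chart n i)
    ⟨P, hP.mem_chart⟩ hX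
  have h2 : chartEquiv i p g ∈ (X.ideal (chart n i)).radical := by
    rw [h1]
    by_contra hcon
    exact (hP.mem_basicOpen_iff g).mp
      (((chart n i).2.mem_basicOpen_iff ⟨P, hP.mem_chart⟩ _).mpr hcon) hg
  obtain ⟨k, hk⟩ := h2
  exact ⟨k, by rw [chartIdeal, Ideal.mem_comap, map_pow]; exact hk⟩

/-- A curve is cut out near a smooth point by the kernel of a map to a discrete valuation ring. -/
theorem exists_isLocalRingAtOrigin (hP : IsCoordinates P i p) (hPc : IsClosed {P})
    {C : ClosedSubscheme n} (hC : C.IsCurve) (hCP : C.IsSmoothAt P) :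
    ∃ (D : Type) (_ : CommRing D) (_ : Algebra ℂ D) (_ : IsDomain D)
      (_ : IsDiscreteValuationRing D) (g : MvPolynomial {j // j ≠ i} ℂ →ₐ[ℂ] D),
      IsLocalRingAtOrigin (chartIdeal C i p) g := by
  obtain ⟨x, rfl, hreg⟩ := hCP
  have hx : IsClosed {x} := by
    have h1 := hPc.preimage C.subschemeι.continuous
    convert h1 using 1
    ext y
    exact ⟨fun h => congrArg _ h, fun h => C.subschemeι.isEmbedding.injective h⟩
  obtain ⟨hdom, hdvr⟩ := IsRegularLocalRing.exists_isDiscreteValuationRing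
    (ringKrullDim_stalk_eq_one hC hx)
  let g : MvPolynomial {j // j ≠ i} ℂ →+* C.subscheme.presheaf.stalk x :=
    (C.toStalk (chart n i) x hP.mem_chart).comp (chartEquiv i p : _ →+* _)
  let : Algebra ℂ (C.subscheme.presheaf.stalk x) := (g.comp MvPolynomial.C).toAlgebra
  refine ⟨_, inferInstance, inferInstance, hdom, hdvr, ⟨g, fun c => rfl⟩, ⟨?_, ?_, ?_⟩⟩
  · intro s
    exact (Scheme.IdealSheafData.isUnit_toStalk_iff hP.mem_chart _).trans (hP.mem_basicOpen_iff s)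
  · intro d
    obtain ⟨a, s, hs, e⟩ := Scheme.IdealSheafData.toStalk_surj (U := chart n i) hP.mem_chart d
    obtain ⟨a, rfl⟩ := (chartEquiv i p).surjective a
    obtain ⟨s, rfl⟩ := (chartEquiv i p).surjective s
    exact ⟨a, s, (hP.mem_basicOpen_iff s).mp hs, e⟩
  · intro a
    refine (Scheme.IdealSheafData.toStalk_eq_zero_iff (U := chart n i) hP.mem_chart _).trans ?_
    constructor
    · rintro ⟨s, hs, e⟩
      obtain ⟨s, rfl⟩ := (chartEquiv i p).surjective s
      exact ⟨s, (hP.mem_basicOpen_iff s).mp hs, by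
        rw [chartIdeal, Ideal.mem_comap, map_mul]; exact e⟩
    · rintro ⟨s, hs, e⟩
      rw [chartIdeal, Ideal.mem_comap, map_mul] at e
      exact ⟨_, (hP.mem_basicOpen_iff s).mpr hs, e⟩

end ComplexPn

namespace ComplexPn

open MvPolynomial

variable {n : ℕ}

/-! ### Linear forms -/

variable (n) in
/-- The linear form with given coefficients. -/
noncomputable def linearForm : (Fin (n + 1) → ℂ) →ₗ[ℂ] MvPolynomial (Fin (n + 1)) ℂ :=
  Fintype.linearCombination ℂ X

theorem linearForm_apply (c : Fin (n + 1) → ℂ) : linearForm n c = ∑ j, c j • X j := rfl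

theorem isHomogeneous_linearForm (c : Fin (n + 1) → ℂ) : (linearForm n c).IsHomogeneous 1 := by
  rw [linearForm_apply]
  refine IsHomogeneous.sum _ _ _ fun j _ => ?_
  rw [smul_eq_C_mul]
  simpa using (isHomogeneous_C _ (c j)).mul (isHomogeneous_X ℂ j)

theorem eval_linearForm (v c : Fin (n + 1) → ℂ) : eval v (linearForm n c) = ∑ j, c j * v j := by
  simp [linearForm_apply, smul_eq_C_mul]

theorem linearForm_injective : Function.Injective (linearForm n) := by
  intro c d h
  funext j
  have := congrArg (eval (Pi.single j 1)) h
  simpa [eval_linearForm, Pi.single_apply] using this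

theorem range_linearForm :
    LinearMap.range (linearForm n) = homogeneousSubmodule (Fin (n + 1)) ℂ 1 := by
  rw [homogeneousSubmodule_one_eq_span_X]
  exact Fintype.range_linearCombination ℂ X

theorem exists_linearForm_eq {W : Submodule ℂ (MvPolynomial (Fin (n + 1)) ℂ)}
    (hW : W ≤ homogeneousSubmodule (Fin (n + 1)) ℂ 1) {w : MvPolynomial (Fin (n + 1)) ℂ}
    (hw : w ∈ W) : ∃ c, linearForm n c = w := by
  have := hW hw
  rw [← range_linearForm] at this
  exact this

/-- The linear forms vanishing at two points. -/
noncomputable def formsThrough (p q : Fin (n + 1) → ℂ) :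
    Submodule ℂ (MvPolynomial (Fin (n + 1)) ℂ) :=
  homogeneousSubmodule (Fin (n + 1)) ℂ 1 ⊓
    (LinearMap.ker (aeval (R := ℂ) p).toLinearMap ⊓ LinearMap.ker (aeval (R := ℂ) q).toLinearMap)

theorem mem_formsThrough {p q : Fin (n + 1) → ℂ} {w : MvPolynomial (Fin (n + 1)) ℂ} :
    w ∈ formsThrough p q ↔ w.IsHomogeneous 1 ∧ eval p w = 0 ∧ eval q w = 0 := by
  simp [formsThrough, mem_homogeneousSubmodule, aeval_eq_eval]

theorem finrank_formsThrough {p q : Fin (n + 1) → ℂ} {i : Fin (n + 1)} (hp : p i = 1)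
    (hq : q i = 0) (hq0 : q ≠ 0) : Module.finrank ℂ (formsThrough p q) + 1 = n := by
  let Λ : (Fin (n + 1) → ℂ) →ₗ[ℂ] ℂ × ℂ :=
    (((aeval (R := ℂ) p).toLinearMap).prod ((aeval (R := ℂ) q).toLinearMap)) ∘ₗ linearForm n
  have hΛ : ∀ c, Λ c = (∑ j, c j * p j, ∑ j, c j * q j) := fun c => by
    simp [Λ, aeval_eq_eval, eval_linearForm]
  have hsurj : Function.Surjective Λ := by
    obtain ⟨j, hj⟩ := Function.ne_iff.mp hq0
    have hj : q j ≠ 0 := hj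
    rintro ⟨a, b⟩
    refine ⟨Pi.single i (a - b * (q j)⁻¹ * p j) + Pi.single j (b * (q j)⁻¹), ?_⟩
    rw [hΛ]
    simp [add_mul, Finset.sum_add_distrib, Pi.single_apply, hp, hq, hj]
  have hmap : (LinearMap.ker Λ).map (linearForm n) = formsThrough p q := by
    ext w
    rw [mem_formsThrough]
    constructor
    · rintro ⟨c, hc, rfl⟩
      have hc : Λ c = 0 := hc
      rw [hΛ, Prod.mk_eq_zero] at hc
      exact ⟨isHomogeneous_linearForm c, by rw [eval_linearForm]; exact hc.1,
        by rw [eval_linearForm]; exact hc.2⟩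
    · rintro ⟨h1, h2, h3⟩
      obtain ⟨c, rfl⟩ := exists_linearForm_eq le_rfl ((mem_homogeneousSubmodule _ _).mpr h1)
      rw [eval_linearForm] at h2 h3
      exact ⟨c, by rw [SetLike.mem_coe, LinearMap.mem_ker, hΛ, h2, h3]; rfl, rfl⟩
  have h1 := LinearMap.finrank_range_add_finrank_ker Λ
  rw [LinearMap.range_eq_top.mpr hsurj, finrank_top] at h1
  rw [← hmap, ← (Submodule.equivMapOfInjective _ linearForm_injective _).finrank_eq]
  simp at h1
  omega

/-- A space of linear forms of codimension two vanishing at `p` consists of all linear forms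
vanishing at `p` and some second point. -/
theorem exists_eq_formsThrough {p : Fin (n + 1) → ℂ} {i : Fin (n + 1)} (hp : p i = 1)
    {W : Submodule ℂ (MvPolynomial (Fin (n + 1)) ℂ)}
    (hW : W ≤ homogeneousSubmodule (Fin (n + 1)) ℂ 1) (hn : Module.finrank ℂ W + 1 = n)
    (hWp : ∀ w ∈ W, eval p w = 0) : ∃ q, q i = 0 ∧ q ≠ 0 ∧ W = formsThrough p q := by
  let W' : Submodule ℂ (Fin (n + 1) → ℂ) := W.comap (linearForm n)
  have hWW' : W'.map (linearForm n) = W := by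
    rw [Submodule.map_comap_eq, range_linearForm]
    exact inf_eq_right.mpr hW
  have hW'n : Module.finrank ℂ W' + 1 = n := by
    rw [← hWW', ← (Submodule.equivMapOfInjective _ linearForm_injective _).finrank_eq] at hn
    exact hn
  let Θ : (Fin (n + 1) → ℂ) →ₗ[ℂ] Module.Dual ℂ W' :=
    W'.dualRestrict ∘ₗ (dotProductEquiv ℂ (Fin (n + 1))).toLinearMap
  have hΘ : ∀ v c, Θ v c = ∑ j, c.1 j * v j := fun v c =>
    (show Θ v c = ∑ j, v j * c.1 j from rfl).trans (Finset.sum_congr rfl fun j _ => mul_comm _ _)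
  have hker : 2 ≤ Module.finrank ℂ (LinearMap.ker Θ) := by
    have h1 := LinearMap.finrank_range_add_finrank_ker Θ
    have h2 : Module.finrank ℂ (LinearMap.range Θ) ≤ Module.finrank ℂ (Module.Dual ℂ W') :=
      Submodule.finrank_le _
    rw [Subspace.dual_finrank_eq] at h2
    simp at h1
    omega
  have hex : ∃ v ∈ LinearMap.ker Θ, v ∉ Submodule.span ℂ {p} := by
    by_contra! hcon
    have h1 := Submodule.finrank_mono (show LinearMap.ker Θ ≤ Submodule.span ℂ {p} from hcon)
    have h2 := finrank_span_singleton (K := ℂ) (show p ≠ 0 from fun h => by simp [h] at hp)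
    omega
  obtain ⟨v, hv, hvp⟩ := hex
  have hq0 : v - v i • p ≠ 0 := fun h => hvp (by
    rw [sub_eq_zero.mp h]
    exact Submodule.smul_mem _ _ (Submodule.mem_span_singleton_self p))
  have hqi : (v - v i • p) i = 0 := by simp [hp]
  refine ⟨v - v i • p, hqi, hq0, ?_⟩
  have hle : W ≤ formsThrough p (v - v i • p) := by
    intro w hw
    obtain ⟨c, rfl⟩ := exists_linearForm_eq hW hw
    have h1 := hWp _ hw
    refine mem_formsThrough.mpr ⟨isHomogeneous_linearForm c, h1, ?_⟩
    have h2 : Θ v ⟨c, hw⟩ = 0 := by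
      rw [LinearMap.mem_ker.mp hv]
      rfl
    rw [hΘ] at h2
    rw [eval_linearForm] at h1 ⊢
    simp only [Pi.sub_apply, Pi.smul_apply, smul_eq_mul, mul_sub, Finset.sum_sub_distrib]
    rw [h2, zero_sub, neg_eq_zero]
    simp_rw [mul_left_comm _ (v i)]
    rw [← Finset.mul_sum, h1, mul_zero]
  have hfin : Module.Finite ℂ (formsThrough p (v - v i • p)) :=
    Submodule.finiteDimensional_of_le (S₂ := LinearMap.range (linearForm n))
      (range_linearForm.symm ▸ inf_le_left)
  refine Submodule.eq_of_le_of_finrank_eq hle ?_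
  have := finrank_formsThrough hp hqi hq0
  omega

end ComplexPn

namespace ComplexPn

open MvPolynomial

variable {n : ℕ} {p q : Fin (n + 1) → ℂ} {i : Fin (n + 1)}

/-! ### Lines -/

/-- The homogeneous parametrisation of the line through two points. -/
noncomputable def lineParam (p q : Fin (n + 1) → ℂ) :
    MvPolynomial (Fin (n + 1)) ℂ →ₐ[ℂ] MvPolynomial (Fin 2) ℂ :=
  aeval fun j => C (p j) * X 0 + C (q j) * X 1

theorem lineParam_X (p q : Fin (n + 1) → ℂ) (j : Fin (n + 1)) :
    lineParam p q (X j) = C (p j) * X 0 + C (q j) * X 1 := by simp [lineParam]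

theorem lineParam_linearForm (c : Fin (n + 1) → ℂ) :
    lineParam p q (linearForm n c) =
      C (eval p (linearForm n c)) * X 0 + C (eval q (linearForm n c)) * X 1 := by
  rw [eval_linearForm, eval_linearForm, linearForm_apply]
  simp only [map_sum, map_smul, lineParam_X, Finset.sum_mul, ← Finset.sum_add_distrib, map_mul]
  simp only [smul_eq_C_mul]
  exact Finset.sum_congr rfl fun j _ => by ring

theorem lineParam_surjective (hp : p i = 1) (hq : q i = 0) (hq0 : q ≠ 0) :
    Function.Surjective (lineParam p q) := by
  obtain ⟨j, hj⟩ := Function.ne_iff.mp hq0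
  have hj : q j ≠ 0 := hj
  rw [← AlgHom.range_eq_top, eq_top_iff, ← adjoin_range_X, Algebra.adjoin_le_iff]
  rintro _ ⟨k, rfl⟩
  match k with
  | 0 => exact ⟨X i, by change lineParam p q (X i) = _; simp [lineParam_X, hp, hq]⟩
  | 1 =>
    refine ⟨C (q j)⁻¹ * (X j - C (p j) * X i), ?_⟩
    change lineParam p q _ = _
    simp only [map_mul, map_sub, lineParam_X, hp, hq, ← algebraMap_eq, AlgHom.commutes]
    simp only [algebraMap_eq, map_one, one_mul, map_zero, zero_mul, add_zero, add_sub_cancel_left]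
    rw [← mul_assoc, ← map_mul, inv_mul_cancel₀ hj, map_one, one_mul]

theorem ker_lineParam (hp : p i = 1) (hq : q i = 0) (hq0 : q ≠ 0) :
    RingHom.ker (lineParam p q) = Ideal.span (formsThrough p q) := by
  obtain ⟨j, hj⟩ := Function.ne_iff.mp hq0
  have hj : q j ≠ 0 := hj
  apply le_antisymm
  · refine ker_le_of_leftInverse _ (aeval ![X i, C (q j)⁻¹ * (X j - C (p j) * X i)]) _ fun k => ?_
    apply Ideal.subset_span
    simp only [lineParam_X, map_add, map_mul, aeval_C, aeval_X, Matrix.cons_val_zero,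
      Matrix.cons_val_one, algebraMap_eq]
    rw [SetLike.mem_coe, mem_formsThrough]
    refine ⟨?_, ?_, ?_⟩
    · have h1 : ∀ (c : ℂ) (l : Fin (n + 1)), (C c * X l).IsHomogeneous 1 := fun c l => by
        simpa using (isHomogeneous_C _ c).mul (isHomogeneous_X ℂ l)
      have h2 : ∀ (c : ℂ) {f : MvPolynomial (Fin (n + 1)) ℂ}, f.IsHomogeneous 1 →
          (C c * f).IsHomogeneous 1 := fun c f hf => by
        simpa using (isHomogeneous_C _ c).mul hf
      exact (isHomogeneous_X ℂ k).sub ((h1 _ _).add (h2 _ (h2 _ ((isHomogeneous_X ℂ j).sub (h1 _ _)))))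
    · simp [hp]
    · simp [hq, hj]
  · rw [Ideal.span_le]
    intro w hw
    obtain ⟨h1, h2, h3⟩ := mem_formsThrough.mp hw
    obtain ⟨c, rfl⟩ := exists_linearForm_eq le_rfl ((mem_homogeneousSubmodule _ _).mpr h1)
    rw [SetLike.mem_coe, RingHom.mem_ker, lineParam_linearForm, h2, h3]
    simp

/-- The line through two points. -/
noncomputable def lineThrough (p q : Fin (n + 1) → ℂ) : ClosedSubscheme n :=
  ClosedSubscheme.reducedZeroLocus (formsThrough p q : Set (MvPolynomial (Fin (n + 1)) ℂ))

theorem isLine_lineThrough (hp : p i = 1) (hq : q i = 0) (hq0 : q ≠ 0) :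
    (lineThrough p q).IsLine :=
  ⟨formsThrough p q, inf_le_left, finrank_formsThrough hp hq hq0, rfl⟩

theorem mem_support_reducedZeroLocus {W : Set (MvPolynomial (Fin (n + 1)) ℂ)} {Q : ComplexPn n} :
    Q ∈ (ClosedSubscheme.reducedZeroLocus W).support ↔ ∀ w ∈ W, w ∈ Q.asHomogeneousIdeal := by
  have h1 : ((ClosedSubscheme.reducedZeroLocus W).support : Set (ComplexPn n)) =
    ProjectiveSpectrum.zeroLocus (coordGrading n) W :=
      Scheme.IdealSheafData.coe_support_vanishingIdeal _
  exact (Set.ext_iff.mp h1 Q).trans Iff.rfl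

theorem mem_support_lineThrough {P : ComplexPn n} (hP : IsCoordinates P i p) :
    P ∈ (lineThrough p q).support := by
  refine mem_support_reducedZeroLocus.mpr fun w hw => ?_
  obtain ⟨h1, h2, -⟩ := mem_formsThrough.mp hw
  exact (hP.mem_iff h1).mpr h2

theorem lineHom_dehom_linearForm (hp : p i = 1) (hq : q i = 0) (c : Fin (n + 1) → ℂ) :
    lineHom (fun s : {j // j ≠ i} => q s) (dehom i p (linearForm n c)) =
      Polynomial.C (eval p (linearForm n c)) +
        Polynomial.X * Polynomial.C (eval q (linearForm n c)) := by
  have h1 : ∀ j, lineHom (fun s : {j // j ≠ i} => q s) (dehom i p (X j)) =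
      Polynomial.C (p j) + Polynomial.X * Polynomial.C (q j) := fun j => by
    by_cases hj : j = i
    · subst hj; simp [hp, hq]
    · rw [dehom_X_of_ne i p ⟨j, hj⟩, map_add, lineHom_X, ← algebraMap_eq, AlgHom.commutes, add_comm]
      rfl
  rw [eval_linearForm, eval_linearForm, linearForm_apply]
  simp only [map_sum, map_smul, h1, Finset.mul_sum, ← Finset.sum_add_distrib, map_mul,
    Polynomial.smul_eq_C_mul]
  exact Finset.sum_congr rfl fun j _ => by ring

theorem dehom_mem_primeIdealOf_iff {Q : ComplexPn n} (hQ : Q ∈ (chart n i).1)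
    {k : ℕ} {f : MvPolynomial (Fin (n + 1)) ℂ} (hf : f.IsHomogeneous k) :
    chartEquiv i p (dehom i p f) ∈ ((chart n i).2.primeIdealOf ⟨Q, hQ⟩).asIdeal ↔
      f ∈ Q.asHomogeneousIdeal := by
  rw [← not_iff_not, ← mem_basicOpen_chartEquiv_dehom hQ p hf]
  exact ((chart n i).2.mem_basicOpen_iff ⟨Q, hQ⟩ _).symm

theorem restrict_ne_zero (hq : q i = 0) (hq0 : q ≠ 0) :
    (fun s : {j // j ≠ i} => q s) ≠ 0 := by
  intro h
  apply hq0
  funext j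
  by_cases hj : j = i
  · rw [hj, hq]; rfl
  · exact congrFun h ⟨j, hj⟩

theorem chartIdeal_lineThrough (hp : p i = 1) (hq : q i = 0) (hq0 : q ≠ 0) :
    chartIdeal (lineThrough p q) i p = RingHom.ker (lineHom fun s : {j // j ≠ i} => q s) := by
  have ha := restrict_ne_zero hq hq0
  have hU : IsAffineOpen (chart n i).1 := (chart n i).2
  have hmem : ∀ g, g ∈ chartIdeal (lineThrough p q) i p ↔
      ∀ y : PrimeSpectrum Γ(ComplexPn n, (chart n i).1),
      (∀ w ∈ formsThrough p q, chartEquiv i p (dehom i p w) ∈ y.asIdeal) →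
        chartEquiv i p g ∈ y.asIdeal := by
    intro g
    have h1 : g ∈ chartIdeal (lineThrough p q) i p ↔
        ∀ y : PrimeSpectrum Γ(ComplexPn n, (chart n i).1),
        (hU.fromSpec y) ∈ (lineThrough p q).support → chartEquiv i p g ∈ y.asIdeal := by
      rw [chartIdeal, Ideal.mem_comap, lineThrough, ClosedSubscheme.reducedZeroLocus,
        Scheme.IdealSheafData.vanishingIdeal_ideal, PrimeSpectrum.mem_vanishingIdeal]
      refine forall_congr' fun y => imp_congr ?_ Iff.rfl
      exact (Set.ext_iff.mp (Scheme.IdealSheafData.coe_support_vanishingIdeal _) _).symm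
    rw [h1]
    refine forall_congr' fun y => imp_congr ?_ Iff.rfl
    have hy := hU.fromSpec_mem y
    refine mem_support_reducedZeroLocus.trans (forall₂_congr fun w hw => ?_)
    rw [← dehom_mem_primeIdealOf_iff hy (mem_formsThrough.mp hw).1]
    rw [show (chart n i).2.primeIdealOf ⟨_, hy⟩ = y from hU.primeIdealOf_fromSpec y hy]
  apply le_antisymm
  · intro g hg
    let I := (RingHom.ker (lineHom fun s : {j // j ≠ i} => q s)).comap (chartEquiv i p).symm
    have hker : (RingHom.ker (lineHom fun s : {j // j ≠ i} => q s)).IsPrime :=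
      RingHom.ker_isPrime _
    have hI : I.IsPrime := Ideal.comap_isPrime _ _
    have h2 := (hmem g).mp hg ⟨I, hI⟩ (fun w hw => by
      obtain ⟨h1, h2, h3⟩ := mem_formsThrough.mp hw
      obtain ⟨c, rfl⟩ := exists_linearForm_eq le_rfl ((mem_homogeneousSubmodule _ _).mpr h1)
      rw [Ideal.mem_comap, RingEquiv.symm_apply_apply, RingHom.mem_ker,
        lineHom_dehom_linearForm hp hq, h2, h3]
      simp)
    rwa [Ideal.mem_comap, RingEquiv.symm_apply_apply] at h2
  · refine ker_lineHom_le ha fun c hc => (hmem _).mpr fun y hy => ?_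
    let w : MvPolynomial (Fin (n + 1)) ℂ :=
      ∑ s : {j // j ≠ i}, C (c s) * (X s.1 - C (p s) * X i)
    have hw : w ∈ formsThrough p q := by
      refine mem_formsThrough.mpr ⟨?_, ?_, ?_⟩
      · refine IsHomogeneous.sum _ _ _ fun s _ => ?_
        have h1 : (C (p s) * X i : MvPolynomial (Fin (n + 1)) ℂ).IsHomogeneous 1 := by
          simpa using (isHomogeneous_C _ (p s)).mul (isHomogeneous_X ℂ i)
        simpa using (isHomogeneous_C _ (c s)).mul ((isHomogeneous_X ℂ s.1).sub h1)
      · simp [w, hp]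
      · simpa [w, hq] using hc
    have hdw : dehom i p w = ∑ s, C (c s) * X s := by
      simp only [w, map_sum, map_mul, map_sub, dehom_X_self, dehom_X_of_ne, mul_one,
        ← algebraMap_eq, AlgHom.commutes]
      simp
    rw [← hdw]
    exact hy w hw

/-- A line is smooth at its points. -/
theorem isSmoothAt_lineThrough {P : ComplexPn n} (hP : IsCoordinates P i p) (hq : q i = 0)
    (hq0 : q ≠ 0) : (lineThrough p q).IsSmoothAt P := by
  have hmem : P ∈ Set.range (lineThrough p q).subschemeι := by
    rw [Scheme.IdealSheafData.range_subschemeι]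
    exact mem_support_lineThrough hP
  obtain ⟨x, rfl⟩ := hmem
  refine ⟨x, rfl, ?_⟩
  refine Scheme.IdealSheafData.isRegularLocalRing_stalk (U := chart n i) hP.mem_chart ?_
  have ha := restrict_ne_zero hq hq0
  have e1 : (MvPolynomial {j // j ≠ i} ℂ ⧸ chartIdeal (lineThrough p q) i p) ≃+*
      (Γ(ComplexPn n, (chart n i).1) ⧸ (lineThrough p q).ideal (chart n i)) :=
    Ideal.quotientEquiv _ _ (chartEquiv i p)
      (Ideal.map_comap_of_surjective _ (chartEquiv i p).surjective _).symm
  have e2 := (Ideal.quotEquivOfEq (chartIdeal_lineThrough hP.apply_eq_one hq hq0)).trans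
    (RingHom.quotientKerEquivOfSurjective (lineHom_surjective ha))
  exact IsRegularRing.of_ringEquiv (e2.symm.trans e1)

theorem asHomogeneousIdeal_lt_ker_constantCoeff (Q : ComplexPn n) :
    Q.asHomogeneousIdeal.toIdeal < RingHom.ker (constantCoeff (σ := Fin (n + 1)) (R := ℂ)) := by
  have hproj : ∀ f : MvPolynomial (Fin (n + 1)) ℂ,
      GradedRing.proj (coordGrading n) 0 f = C (constantCoeff f) := fun f => by
    rw [GradedRing.proj_apply]
    exact (decomposition.decompose'_apply f 0).trans (homogeneousComponent_zero f)
  refine lt_of_le_not_ge (fun f hf => ?_) fun hle => Q.not_irrelevant_le fun f hf => hle ?_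
  · rw [RingHom.mem_ker]
    by_contra hcon
    have h1 : GradedRing.proj (coordGrading n) 0 f ∈ Q.asHomogeneousIdeal.toIdeal :=
      Q.asHomogeneousIdeal.isHomogeneous 0 hf
    rw [hproj] at h1
    exact Q.isPrime.ne_top (Ideal.eq_top_of_isUnit_mem _ h1 ((IsUnit.mk0 _ hcon).map C))
  · have h1 := (HomogeneousIdeal.mem_irrelevant_iff _ _).mp hf
    rw [hproj, C_eq_zero] at h1
    exact h1

theorem ker_lineParam_le (hp : p i = 1) (hq : q i = 0) (hq0 : q ≠ 0) {Q : ComplexPn n}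
    (hQ : Q ∈ (lineThrough p q).support) :
    RingHom.ker (lineParam p q) ≤ Q.asHomogeneousIdeal.toIdeal := by
  rw [ker_lineParam hp hq hq0, Ideal.span_le]
  exact mem_support_reducedZeroLocus.mp hQ

/-- The generic point of a line. -/
theorem exists_genericPoint_lineThrough (hp : p i = 1) (hq : q i = 0) (hq0 : q ≠ 0) :
    ∃ η : ComplexPn n, η.asHomogeneousIdeal.toIdeal = RingHom.ker (lineParam p q) := by
  have hh : (RingHom.ker (lineParam p q)).IsHomogeneous (coordGrading n) := by
    rw [ker_lineParam hp hq hq0]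
    exact Ideal.homogeneous_span _ _ fun w hw => ⟨1, (mem_formsThrough.mp hw).1⟩
  refine ⟨⟨⟨RingHom.ker (lineParam p q), hh⟩, RingHom.ker_isPrime _, fun hle => ?_⟩, rfl⟩
  have h1 : (X i : MvPolynomial (Fin (n + 1)) ℂ) ∈
      HomogeneousIdeal.irrelevant (coordGrading n) :=
    HomogeneousIdeal.mem_irrelevant_of_mem _ one_pos (X_mem_coordGrading i)
  have h2 : lineParam p q (X i) = 0 := hle h1
  rw [lineParam_X, hp, hq] at h2
  simp at h2

theorem mem_support_of_ker_le {Q : ComplexPn n} (hp : p i = 1) (hq : q i = 0) (hq0 : q ≠ 0)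
    (h : RingHom.ker (lineParam p q) ≤ Q.asHomogeneousIdeal.toIdeal) :
    Q ∈ (lineThrough p q).support :=
  mem_support_reducedZeroLocus.mpr fun _ hw =>
    h (ker_lineParam hp hq hq0 ▸ Ideal.subset_span hw)

/-- There is no chain of three strict inclusions of primes in `ℂ[x, y]`. -/
theorem not_lt_of_lt_of_lt {a b c d : PrimeSpectrum (MvPolynomial (Fin 2) ℂ)} (h1 : a < b)
    (h2 : b < c) : ¬ c < d := by
  intro h3
  let s : LTSeries (PrimeSpectrum (MvPolynomial (Fin 2) ℂ)) :=
    { length := 3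
      toFun := ![a, b, c, d]
      step := fun k => by
        match k with
        | 0 => exact h1
        | 1 => exact h2
        | 2 => exact h3 }
  have h4 := Order.LTSeries.length_le_krullDim s
  have h5 : Order.krullDim (PrimeSpectrum (MvPolynomial (Fin 2) ℂ)) = 2 := by
    have := MvPolynomial.ringKrullDim_of_isNoetherianRing (R := ℂ) (ι := Fin 2)
    rw [ringKrullDim_eq_zero_of_field] at this
    simpa [ringKrullDim] using this
  rw [h5] at h4
  have h6 : s.length = 3 := rfl
  rw [h6] at h4
  exact absurd h4 (by decide)

theorem isCurve_lineThrough {P : ComplexPn n} (hP : IsCoordinates P i p) (hq : q i = 0)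
    (hq0 : q ≠ 0) : (lineThrough p q).IsCurve := by
  have hp := hP.apply_eq_one
  have hmem : ∀ t : (lineThrough p q).subscheme,
      (lineThrough p q).subschemeι t ∈ (lineThrough p q).support := fun t => by
    have := Set.mem_range_self (f := (lineThrough p q).subschemeι) t
    rwa [Scheme.IdealSheafData.range_subschemeι] at this
  have hsurj : ∀ Q ∈ (lineThrough p q).support, ∃ t, (lineThrough p q).subschemeι t = Q := by
    intro Q hQ
    have : Q ∈ ((lineThrough p q).support : Set (ComplexPn n)) := hQ
    rwa [← Scheme.IdealSheafData.range_subschemeι] at this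
  have hspec : ∀ s t : (lineThrough p q).subscheme, s ∈ closure {t} ↔
      ((lineThrough p q).subschemeι t).asHomogeneousIdeal ≤
        ((lineThrough p q).subschemeι s).asHomogeneousIdeal := by
    intro s t
    rw [← specializes_iff_mem_closure,
      ← (lineThrough p q).subschemeι.isEmbedding.isInducing.specializes_iff,
      specializes_iff_mem_closure]
    exact (ProjectiveSpectrum.le_iff_mem_closure _ _ _).symm
  obtain ⟨η, hη⟩ := exists_genericPoint_lineThrough hp hq hq0
  obtain ⟨t₀, rfl⟩ := hsurj η (mem_support_of_ker_le hp hq hq0 hη.ge)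
  have huniv : closure {t₀} = (Set.univ : Set (lineThrough p q).subscheme) := by
    refine Set.eq_univ_of_forall fun t => (hspec t t₀).mpr ?_
    have := ker_lineParam_le hp hq hq0 (hmem t)
    rw [← hη] at this
    exact this
  have hirr : IrreducibleSpace (lineThrough p q).subscheme := by
    refine (irreducibleSpace_def _).mpr ?_
    rw [Set.top_eq_univ, ← huniv]
    exact isIrreducible_singleton.closure
  intro Z hZ
  rw [irreducibleComponents_eq_singleton, Set.mem_singleton_iff] at hZ
  subst hZ
  rw [IsHomeomorph.topologicalKrullDim_eq _ (Homeomorph.Set.univ _).isHomeomorph]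
  apply le_antisymm
  · rw [topologicalKrullDim, Order.krullDim_le_one_iff]
    intro A
    by_contra! hcon
    obtain ⟨B, hB⟩ := not_isMin_iff.mp hcon.1
    obtain ⟨D, hD⟩ := not_isMax_iff.mp hcon.2
    let y : TopologicalSpace.IrreducibleCloseds (lineThrough p q).subscheme →
        PrimeSpectrum (MvPolynomial (Fin (n + 1)) ℂ) := fun A =>
      ⟨((lineThrough p q).subschemeι A.isIrreducible.genericPoint).asHomogeneousIdeal.toIdeal,
        ProjectiveSpectrum.isPrime _⟩
    have hgen : ∀ A : TopologicalSpace.IrreducibleCloseds (lineThrough p q).subscheme,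
        closure {A.isIrreducible.genericPoint} = (A : Set (lineThrough p q).subscheme) := fun A =>
      A.isIrreducible.genericPoint_closure_eq.trans A.isClosed.closure_eq
    have hle : ∀ A B, A ≤ B ↔ y B ≤ y A := fun A B => by
      refine Iff.trans ?_ (hspec A.isIrreducible.genericPoint B.isIrreducible.genericPoint)
      rw [hgen B]
      constructor
      · intro h
        have h1 : A.isIrreducible.genericPoint ∈ (A : Set (lineThrough p q).subscheme) :=
          (hgen A).subset (subset_closure (Set.mem_singleton _))
        exact h h1
      · intro h
        have h1 : (A : Set (lineThrough p q).subscheme) ⊆ B := by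
          rw [← hgen A]
          exact B.isClosed.closure_subset_iff.mpr (Set.singleton_subset_iff.mpr h)
        exact h1
    have hlt : ∀ {A B}, A < B → y B < y A := fun {A B} h =>
      lt_of_le_not_ge ((hle _ _).mp h.le) fun h' => h.not_ge ((hle _ _).mpr h')
    have hker : ∀ A, RingHom.ker (lineParam p q) ≤ (y A).asIdeal := fun A =>
      ker_lineParam_le hp hq hq0 (hmem _)
    have hs := lineParam_surjective hp hq hq0
    have hlift : ∀ z : PrimeSpectrum (MvPolynomial (Fin (n + 1)) ℂ),
        RingHom.ker (lineParam p q) ≤ z.asIdeal →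
        ∃ z' : PrimeSpectrum (MvPolynomial (Fin 2) ℂ),
          z'.asIdeal.comap (lineParam p q) = z.asIdeal := fun z hz =>
      ⟨⟨z.asIdeal.map (lineParam p q), Ideal.map_isPrime_of_surjective hs hz⟩, by
        rw [Ideal.comap_map_of_surjective' _ hs]
        exact sup_eq_left.mpr hz⟩
    have hlift_lt : ∀ {I J : Ideal (MvPolynomial (Fin 2) ℂ)},
        I.comap (lineParam p q) < J.comap (lineParam p q) → I < J := fun {I J} h =>
      lt_of_le_not_ge ((Ideal.comap_le_comap_iff_of_surjective _ hs _ _).mp h.le)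
        fun h' => h.not_ge (Ideal.comap_mono h')
    obtain ⟨a, ha⟩ := hlift (y D) (hker D)
    obtain ⟨b, hb⟩ := hlift (y A) (hker A)
    obtain ⟨c, hc⟩ := hlift (y B) (hker B)
    have hBm := asHomogeneousIdeal_lt_ker_constantCoeff
      ((lineThrough p q).subschemeι B.isIrreducible.genericPoint)
    obtain ⟨d, hd⟩ := hlift ⟨RingHom.ker (constantCoeff (σ := Fin (n + 1)) (R := ℂ)),
      RingHom.ker_isPrime _⟩ ((hker B).trans hBm.le)
    refine not_lt_of_lt_of_lt (a := a) (b := b) (c := c) (d := d) ?_ ?_ ?_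
    · exact hlift_lt (by rw [ha, hb]; exact hlt hD)
    · exact hlift_lt (by rw [hb, hc]; exact hlt hB)
    · exact hlift_lt (by rw [hc, hd]; exact hBm)
  · rw [topologicalKrullDim, Order.one_le_krullDim_iff]
    obtain ⟨j, hj⟩ := Function.ne_iff.mp hq0
    have hj : q j ≠ 0 := hj
    obtain ⟨t₁, ht₁⟩ := hsurj P (mem_support_lineThrough hP)
    refine ⟨⟨closure {t₁}, isIrreducible_singleton.closure, isClosed_closure⟩,
      ⟨Set.univ, IrreducibleSpace.isIrreducible_univ _, isClosed_univ⟩, lt_of_le_not_ge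
        (fun _ _ => Set.mem_univ _) fun hle => ?_⟩
    have h1 := (hspec t₀ t₁).mp (hle (Set.mem_univ t₀))
    rw [ht₁] at h1
    have h2 : (X j - C (p j) * X i : MvPolynomial (Fin (n + 1)) ℂ).IsHomogeneous 1 := by
      simpa using (isHomogeneous_X ℂ j).sub
        (by simpa using (isHomogeneous_C _ (p j)).mul (isHomogeneous_X ℂ i))
    have h3 : X j - C (p j) * X i ∈
        ((lineThrough p q).subschemeι t₀).asHomogeneousIdeal.toIdeal :=
      h1 ((hP.mem_iff h2).mpr (by simp [hp]))
    rw [hη, RingHom.mem_ker, map_sub, map_mul, lineParam_X, lineParam_X, hp, hq,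
      show lineParam p q (C (p j)) = C (p j) from (lineParam p q).commutes (p j)] at h3
    simp [hj] at h3

end ComplexPn

theorem mainTheorem3 (n m : ℕ) (P : ComplexPn n) (X : ClosedSubscheme n)
    (hX : X.IsZeroDimSupportedAt P) :
    X.IsSymmetric P m ↔
      ∀ C : ClosedSubscheme n, C.IsCurve → C.IsSmoothAt P → (X.inter C).length = m := by
  have hPc : IsClosed {P} := hX.2 ▸ X.support.isClosed
  obtain ⟨i, p, hP⟩ := ComplexPn.exists_isCoordinates hPc
  constructor
  · intro hsym C hC hCP
    obtain ⟨D, _, _, _, _, g, hg⟩ := ComplexPn.exists_isLocalRingAtOrigin hP hPc hC hCP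
    obtain ⟨N, hN⟩ := ComplexPn.exists_pow_le_chartIdeal hP hX.2
    have hPX : P ∈ X.support := by
      have : P ∈ (X.support : Set (ComplexPn n)) := by rw [hX.2]; rfl
      exact this
    rw [ComplexPn.length_inter hP hX.2]
    refine hg.length_eq_of_lines (ComplexPn.chartIdeal_le hP hPX) hN fun a ha => ?_
    let q : Fin (n + 1) → ℂ := fun j => if h : j = i then 0 else a ⟨j, h⟩
    have hqi : q i = 0 := by simp [q]
    have hqa : (fun s : {j // j ≠ i} => q s) = a := by
      funext s
      simp [q, s.2]
    have hq0 : q ≠ 0 := fun h => ha (by rw [← hqa, h]; rfl)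
    have h1 := hsym _ (ComplexPn.isLine_lineThrough hP.apply_eq_one hqi hq0)
      (ComplexPn.mem_support_lineThrough hP)
    rwa [ComplexPn.length_inter hP hX.2,
      ComplexPn.chartIdeal_lineThrough hP.apply_eq_one hqi hq0, hqa] at h1
  · rintro h L ⟨W, hW, hn, rfl⟩ hPL
    obtain ⟨q, hqi, hq0, rfl⟩ := ComplexPn.exists_eq_formsThrough hP.apply_eq_one hW hn
      fun w hw => (hP.mem_iff (hW hw)).mp (ComplexPn.mem_support_reducedZeroLocus.mp hPL w hw)
    exact h _ (ComplexPn.isCurve_lineThrough hP hqi hq0)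
      (ComplexPn.isSmoothAt_lineThrough hP hqi hq0)
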